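/- A double directed graph on $[n]$ is a structure $G=([n],R_1,R_2)$ with two irreflexive binary relations. For reals $0<\alpha_1<\alpha_2<\frac14$ let $G_{n,\bar\alpha}$ be the random double directed graph in which, independently for all ordered pairs $a\neq b$ and both relations, $R_2(a,b)$ holds with probability $n^{-(1-\alpha_2)}$ and $R_1(a,b)$ holds with probability $n^{-(1+\alpha_1)}$. "Every random enough $G_{n,\bar\alpha}$ has property $P$" means that $\mathrm{Prob}(G_{n,\bar\alpha}\text{ has }P)\to 1$ as $n\to\infty$. For a finite double directed graph $G$ and a node $a$, let $S_{G,a,0}=\{a\}$. Given $S_{G,a,0},\dots,S_{G,a,k}$, with union $U_k$, let $S_{G,a,k+1}$ be the set of all $b\notin U_k$ with $R_1(c,b)$ for some $c\in S_{G,a,k}$ if this set is not empty; otherwise let it be the set of all $b\notin U_k$ with $R_2(c,b)$ for some $c\in S_{G,a,k}$. If both sets are empty the construction stops, $\mathrm{height}(a,G)=k$, and all later $S_{G,a,m}$ are empty. Let $\mathrm{height}(G)=\max_a\mathrm{height}(a,G)$. Let $E_G$ be the 4-ary relation of all $(a_1,b_1,a_2,b_2)$ such that for some $k_1\le k_2$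 we have $b_1\in S_{G,a_1,k_1}$ and $b_2\in S_{G,a_2,k_2}$. (1) Let $0<\alpha_1<\alpha_2<\frac14$ and $K_n=\lfloor \frac12 n^{1-2\alpha_2}\rfloor$. Every random enough $G=G_{n,\bar\alpha}$ satisfies: for all nodes $a$ and all $k\le K_n$, the set $S_{G,a,k}$ is nonempty and has at most $n^{2\alpha_2}$ elements. Moreover, every random enough $G=G_{n,\bar\alpha}$ satisfies $\mathrm{height}(G)\ge K_n$. (2) There is a natural number $\mathbf k_0$ such that the following holds when $L$ is inductive logic (least fixed point logic), and also when $L$ is $\mathbb L_{\infty,\mathbf k}$ (infinitary logic with $\mathbf k$ variables) for any $\mathbf k\ge\mathbf k_0$. (a) The relation $E_G$ is definable in $L$, by one formula for all finite double directed graphs $G$. (b) There is a parameter-free scheme of $L$-formulas, on pairs of nodes and with $E_G$ as the formula for the order, that interprets in every double directed graph $G$ on $[n]$, $n\ge1$, the initial segment $\{0,1,\dots,\mathrm{height}(G)\}$ of the natural numbers with its linear order and the (graphs of the) operations $+$ and $\times$. (c) For all $0<\alpha_1<\alpha_2<\frac14$ the 0-1 law fails for $L$ and $G_{n,\bar\alpha}$: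 it is not true that for every sentence $\psi$ of $L$ the probability $\mathrm{Prob}(G_{n,\bar\alpha}\models\psi)$ converges to $0$ or to $1$. -/

import Mathlib

open Filter Topology

noncomputable section

/-! ### Double directed graphs and the random double directed graph -/

/-- The ordered pairs of distinct nodes. -/
abbrev NodePair (n : ℕ) : Type := {e : Fin n × Fin n // e.1 ≠ e.2}

/-- A double directed graph on the node set `Fin n`: two irreflexive binary relations `R₁`
(index `0`) and `R₂` (index `1`), given by their truth values on the pairs of distinct nodes. -/
abbrev DoubleDigraph (n : ℕ) : Type := Fin 2 × NodePair n → Bool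

/-- `R 0 a b` is `R₁(a,b)` and `R 1 a b` is `R₂(a,b)`. -/
def DoubleDigraph.R {n : ℕ} (G : DoubleDigraph n) (i : Fin 2) (a b : Fin n) : Prop :=
  ∃ h : a ≠ b, G (i, ⟨(a, b), h⟩) = true

/-- Edge probabilities: `n^{-(1+α₁)}` for `R₁` and `n^{-(1-α₂)}` for `R₂`. -/
def edgeProb (α₁ α₂ : ℝ) (n : ℕ) : Fin 2 → ℝ :=
  ![(n : ℝ) ^ (-(1 + α₁)), (n : ℝ) ^ (-(1 - α₂))]

/-- The distribution of `G_{n,ᾱ}`: all truth values are drawn independently. -/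
def weight (α₁ α₂ : ℝ) (n : ℕ) (G : DoubleDigraph n) : ℝ :=
  ∏ e : Fin 2 × NodePair n,
    if G e = true then edgeProb α₁ α₂ n e.1 else 1 - edgeProb α₁ α₂ n e.1

open Classical in
/-- The probability that `G_{n,ᾱ}` has the property `P`. -/
def prob (α₁ α₂ : ℝ) (n : ℕ) (P : DoubleDigraph n → Prop) : ℝ :=
  ∑ G : DoubleDigraph n, if P G then weight α₁ α₂ n G else 0

/-- "Every random enough `G_{n,ᾱ}` has the property `P`". -/
def RandomEnough (α₁ α₂ : ℝ) (P : ∀ n : ℕ, DoubleDigraph n → Prop) : Prop :=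
  Tendsto (fun n => prob α₁ α₂ n (P n)) atTop (𝓝 1)

/-! ### Layers and height -/

namespace DoubleDigraph

variable {n : ℕ}

open Classical in
/-- The nodes outside `U` that are reached by an `R i`-edge from a node of `S`. -/
def exits (G : DoubleDigraph n) (i : Fin 2) (S U : Finset (Fin n)) : Finset (Fin n) :=
  Finset.univ.filter fun b => b ∉ U ∧ ∃ a ∈ S, G.R i a b

open Classical in
/-- The layer after `S` when the nodes of `U` are already used: the `R₁`-exits if there are any,
and otherwise the `R₂`-exits. -/
def next (G : DoubleDigraph n) (S U : Finset (Fin n)) : Finset (Fin n) :=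
  if (G.exits 0 S U).Nonempty then G.exits 0 S U else G.exits 1 S U

/-- The layer `S_{G,a,k}`; it is empty once the construction has stopped. -/
def layer (G : DoubleDigraph n) (a : Fin n) : ℕ → Finset (Fin n)
  | 0 => {a}
  | k + 1 => G.next (layer G a k) (Finset.univ.biUnion fun m : Fin (k + 1) => layer G a m)

/-- The construction from `a` stops at `k`: no `R₁`-edge and no `R₂`-edge leads from `S_{G,a,k}`
to a node outside `S_{G,a,0} ∪ ⋯ ∪ S_{G,a,k}`. -/
def StopsAt (G : DoubleDigraph n) (a : Fin n) (k : ℕ) : Prop :=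
  ∀ i : Fin 2, ∀ c ∈ G.layer a k, ∀ b, G.R i c b → ∃ m ≤ k, b ∈ G.layer a m

/-- The `k` at which the construction from `a` stops (it does, since the graph is finite). -/
def heightAt (G : DoubleDigraph n) (a : Fin n) : ℕ := sInf {k | G.StopsAt a k}

/-- The height of `G`: the maximum of the heights of its nodes. -/
def height (G : DoubleDigraph n) : ℕ := Finset.univ.sup fun a => G.heightAt a

end DoubleDigraph

/-! ### Queries and logics -/

/-- An `r`-ary relation on every finite double directed graph. -/
abbrev Query (r : ℕ) : Type := ∀ n : ℕ, DoubleDigraph n → (Fin r → Fin n) → Prop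

/-- A logic, given by the queries of each arity that one of its formulas defines. -/
abbrev DefinabilityLogic : Type := ∀ r : ℕ, Query r → Prop

/-- Relation variables of arity `r` in a context, which is a list of arities. -/
inductive RelVar : List ℕ → ℕ → Type
  | here {Γ : List ℕ} {r : ℕ} : RelVar (r :: Γ) r
  | there {Γ : List ℕ} {r s : ℕ} : RelVar Γ r → RelVar (s :: Γ) r

/-- A value on the set `A` for each relation variable of a context. -/
abbrev RelEnv (A : Type) (Γ : List ℕ) : Type := ∀ r : ℕ, RelVar Γ r → (Fin r → A) → Prop

/-- The environment of the empty context. -/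
def RelEnv.nil {A : Type} : RelEnv A [] := fun _ X => nomatch X

/-- Adding a value for one more relation variable. -/
def RelEnv.cons {A : Type} {Γ : List ℕ} {s : ℕ} (T : (Fin s → A) → Prop) (ρ : RelEnv A Γ) :
    RelEnv A (s :: Γ)
  | _, .here => T
  | _, .there X => ρ _ X

/-- Formulas of inductive logic (least fixed point logic, LFP) in the vocabulary of double directed
graphs, with free element variables indexed by `Fin m`. The relation variables of `P` may occur
only positively (under an even number of negations) and those of `N` only negatively; a negation
exchanges the two contexts, and `lfp r φ x` stands for `[lfp_{X, y₁ … y_r} φ](x₁, …, x_r)`, whose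
relation variable `X` has to be positive in `φ`. Element parameters are allowed in `φ`. -/
inductive LFPFormula : List ℕ → List ℕ → ℕ → Type
  | eq {P N : List ℕ} {m : ℕ} (x y : Fin m) : LFPFormula P N m
  | edge {P N : List ℕ} {m : ℕ} (i : Fin 2) (x y : Fin m) : LFPFormula P N m
  | rvar {P N : List ℕ} {m r : ℕ} (X : RelVar P r) (x : Fin r → Fin m) : LFPFormula P N m
  | neg {P N : List ℕ} {m : ℕ} (φ : LFPFormula N P m) : LFPFormula P N m
  | and {P N : List ℕ} {m : ℕ} (φ ψ : LFPFormula P N m) : LFPFormula P N m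
  | ex {P N : List ℕ} {m : ℕ} (φ : LFPFormula P N (m + 1)) : LFPFormula P N m
  | lfp {P N : List ℕ} {m : ℕ} (r : ℕ) (φ : LFPFormula (r :: P) N (m + r))
      (x : Fin r → Fin m) : LFPFormula P N m

/-- Satisfaction. The operator defined by `φ` in `lfp r φ x` is monotone, so that its least fixed
point is the intersection of all the relations that are closed under it. -/
def LFPFormula.Sat {n : ℕ} (G : DoubleDigraph n) : {P N : List ℕ} → {m : ℕ} → LFPFormula P N m →
    RelEnv (Fin n) P → RelEnv (Fin n) N → (Fin m → Fin n) → Prop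
  | _, _, _, .eq x y, _, _, v => v x = v y
  | _, _, _, .edge i x y, _, _, v => G.R i (v x) (v y)
  | _, _, _, .rvar X x, ρ, _, v => ρ _ X (fun j => v (x j))
  | _, _, _, .neg φ, ρ, η, v => ¬ φ.Sat G η ρ v
  | _, _, _, .and φ ψ, ρ, η, v => φ.Sat G ρ η v ∧ ψ.Sat G ρ η v
  | _, _, _, .ex φ, ρ, η, v => ∃ b : Fin n, φ.Sat G ρ η (Fin.snoc v b)
  | _, _, _, .lfp r φ x, ρ, η, v =>
      ∀ T : (Fin r → Fin n) → Prop,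
        (∀ y : Fin r → Fin n, φ.Sat G (RelEnv.cons T ρ) η (Fin.append v y) → T y) →
          T (fun j => v (x j))

/-- Inductive logic: a query is definable if one formula without free relation variables
defines it on all finite double directed graphs. -/
def inductiveLogic : DefinabilityLogic := fun r Q =>
  ∃ φ : LFPFormula [] [] r, ∀ (n : ℕ) (G : DoubleDigraph n) (x : Fin r → Fin n),
    φ.Sat G RelEnv.nil RelEnv.nil x ↔ Q n G x

/-- Formulas of the infinitary logic `L_{∞,k}`: conjunctions over arbitrary sets are allowed, and
only the `k` element variables indexed by `Fin k` are used, free or bound. -/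
inductive InfFormula (k : ℕ) : Type 1
  | eq (x y : Fin k) : InfFormula k
  | edge (i : Fin 2) (x y : Fin k) : InfFormula k
  | neg (φ : InfFormula k) : InfFormula k
  | conj (I : Type) (φ : I → InfFormula k) : InfFormula k
  | ex (x : Fin k) (φ : InfFormula k) : InfFormula k

/-- Satisfaction for `L_{∞,k}`. -/
def InfFormula.Sat {k n : ℕ} (G : DoubleDigraph n) : InfFormula k → (Fin k → Fin n) → Prop
  | .eq x y, v => v x = v y
  | .edge i x y, v => G.R i (v x) (v y)
  | .neg φ, v => ¬ φ.Sat G v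
  | .conj _ φ, v => ∀ j, (φ j).Sat G v
  | .ex x φ, v => ∃ b : Fin n, φ.Sat G (Function.update v x b)

/-- The logic `L_{∞,k}`: an `r`-ary query is definable if one formula, whose truth value depends
only on the first `r` of the `k` variables, defines it on all finite double directed graphs. -/
def infinitaryLogic (k : ℕ) : DefinabilityLogic := fun r Q =>
  ∃ (h : r ≤ k) (φ : InfFormula k), ∀ (n : ℕ) (G : DoubleDigraph n) (v : Fin k → Fin n),
    φ.Sat G v ↔ Q n G (fun j => v (Fin.castLE h j))

/-- The 0-1 law for the random graphs `G_{n,ᾱ}` and the logic `L`: the probability of each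
sentence (formula without free variables) of `L` converges to `0` or to `1`. -/
def ZeroOneLaw (α₁ α₂ : ℝ) (L : DefinabilityLogic) : Prop :=
  ∀ Q : Query 0, L 0 Q →
    Tendsto (fun n => prob α₁ α₂ n fun G => Q n G Fin.elim0) atTop (𝓝 0) ∨
    Tendsto (fun n => prob α₁ α₂ n fun G => Q n G Fin.elim0) atTop (𝓝 1)

/-! ### The level comparison and interpretations -/

/-- The relation of all `(a₁, b₁, a₂, b₂)` such that, for some `k₁ ≤ k₂`, `b₁ ∈ S_{G,a₁,k₁}` and
`b₂ ∈ S_{G,a₂,k₂}`. -/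
def levelLE : Query 4 := fun _ G v =>
  ∃ k₁ k₂ : ℕ, v 1 ∈ G.layer (v 0) k₁ ∧ v 3 ∈ G.layer (v 2) k₂ ∧ k₁ ≤ k₂

/-- A `d`-dimensional scheme of interpretation, without parameters, for structures with an order
and two ternary relations (the graphs of addition and multiplication). -/
structure ArithScheme (d : ℕ) where
  dom : Query d
  eq : Query (d + d)
  le : Query (d + d)
  add : Query (d + d + d)
  mul : Query (d + d + d)

namespace ArithScheme

variable {d : ℕ}

/-- All the relations of the scheme are definable in the logic `L`. -/
def DefinableIn (S : ArithScheme d) (L : DefinabilityLogic) : Prop :=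
  L _ S.dom ∧ L _ S.eq ∧ L _ S.le ∧ L _ S.add ∧ L _ S.mul

/-- In `G` the scheme interprets the initial segment `{0, …, m - 1}` of arithmetic, with its
linear order, its addition and its multiplication: `f` induces an isomorphism onto it from the
interpreted structure, whose elements are the `eq`-classes of tuples in `dom`. -/
def Interprets {n : ℕ} (S : ArithScheme d) (G : DoubleDigraph n) (m : ℕ) : Prop :=
  ∃ f : (Fin d → Fin n) → ℕ,
    f '' {x | S.dom n G x} = Set.Iio m ∧
    (∀ x y, S.dom n G x → S.dom n G y →
      (S.eq n G (Fin.append x y) ↔ f x = f y) ∧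
      (S.le n G (Fin.append x y) ↔ f x ≤ f y)) ∧
    (∀ x y z, S.dom n G x → S.dom n G y → S.dom n G z →
      (S.add n G (Fin.append (Fin.append x y) z) ↔ f x + f y = f z) ∧
      (S.mul n G (Fin.append (Fin.append x y) z) ↔ f x * f y = f z))

end ArithScheme

end

/-! Probability. The layers from a node are explored one at a time. The layers up to index `j` are
determined by the edges leaving the layers before `j`, while the next layer depends, given those,
only on edges leaving layer `j`. The layers are disjoint, so this step is independent of the history
(`layer_congr`, `next_congr`, `bernoulliProb_and`). Put `M = n^(2α₂)` and `t = n^((α₁+α₂)/2)`. While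
at most half of the nodes are used, `R₂`-exits exist almost surely, and a layer of size at most `M`
has on average far fewer than `M` exits by `R₁`. A layer above the threshold `t` has an `R₁`-exit
almost surely, so that `R₂` is not consulted; a layer below `t` has far fewer than `M` exits by
`R₂`. Every exceptional event has probability at most `exp (-n^δ/2)` with `δ = (α₂-α₁)/2`, which
outweighs the union bound over start nodes and steps. Since `K_n * M ≤ n/2`, the exploration can go
on for `K_n` steps (`bernoulliProb_next_le`, `bernoulliProb_layers_le`).

Definability. The rule "use `R₂` only if there is no `R₁`-exit" is not monotone, so the layers are
not literally the stages of a positive induction. The remedy is stage comparison: "`c` has a level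
and `x` has no smaller one", together with its strict version, is defined by one positive recursion.
With these two relations both "same level as `c`" and "different level from `c`" are positive
(`next_iff`, `notNext_iff`, `target_closed`, `target_least`). Further recursions give equality,
successor, sum and product of levels seen from arbitrary roots. Every level below an occurring one
is inhabited from the same root, so intermediate values are always available. In infinitary logic
each fixed layer is definable with four variables by reusing names, and the arithmetic relations are
disjunctions over all values.

Failure of the 0-1 law. With probability tending to `1` the height lies between roughly `√n / 2` and
`n`. With `X = 2^16^i`, the sentence "`X ≤ height < X^4` for some `i`" is thus almost surely true
along `n = X^3` and almost surely false along `n = X^12` (`not_zeroOneLaw`). -/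

/-! ### Calculus of LFP-definable queries -/

/-- Extending a renaming of relation variables by one more variable. -/
def RelVar.lift {Γ Δ : List ℕ} (f : ∀ r, RelVar Γ r → RelVar Δ r) (s : ℕ) :
    ∀ r, RelVar (s :: Γ) r → RelVar (s :: Δ) r
  | _, .here => .here
  | _, .there X => .there (f _ X)

namespace LFPFormula

/-- Renaming of relation variables and of element variables. -/
def map : {P N P' N' : List ℕ} → {m m' : ℕ} → (∀ r, RelVar P r → RelVar P' r) →
    (∀ r, RelVar N r → RelVar N' r) → (Fin m → Fin m') → LFPFormula P N m → LFPFormula P' N' m'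
  | _, _, _, _, _, _, _, _, h, .eq x y => .eq (h x) (h y)
  | _, _, _, _, _, _, _, _, h, .edge i x y => .edge i (h x) (h y)
  | _, _, _, _, _, _, f, _, h, .rvar X x => .rvar (f _ X) (fun j => h (x j))
  | _, _, _, _, _, _, f, g, h, .neg φ => .neg (φ.map g f h)
  | _, _, _, _, _, _, f, g, h, .and φ ψ => .and (φ.map f g h) (ψ.map f g h)
  | _, _, _, _, _, _, f, g, h, .ex φ =>
      .ex (φ.map f g (Fin.snoc (fun i => (h i).castSucc) (Fin.last _)))
  | _, _, _, _, _, _, f, g, h, .lfp r φ x =>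
      .lfp r (φ.map (RelVar.lift f r) g (Fin.append (fun i => (h i).castAdd r) (Fin.natAdd _)))
        (fun j => h (x j))

theorem sat_map {n : ℕ} (G : DoubleDigraph n) {P N : List ℕ} {m : ℕ} (φ : LFPFormula P N m) :
    ∀ {P' N' : List ℕ} {m' : ℕ} (f : ∀ r, RelVar P r → RelVar P' r)
      (g : ∀ r, RelVar N r → RelVar N' r) (h : Fin m → Fin m') (ρ : RelEnv (Fin n) P')
      (η : RelEnv (Fin n) N') (v : Fin m' → Fin n),
      (φ.map f g h).Sat G ρ η v ↔
        φ.Sat G (fun r X => ρ r (f r X)) (fun r X => η r (g r X)) (fun i => v (h i)) := by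
  induction φ with
  | eq x y => intros; rfl
  | edge i x y => intros; rfl
  | rvar X x => intros; rfl
  | neg φ ih => intros; exact not_congr (ih ..)
  | and φ ψ ih₁ ih₂ => intros; exact and_congr (ih₁ ..) (ih₂ ..)
  | ex φ ih =>
    intro P' N' m' f g h ρ η v
    refine exists_congr fun b => (ih ..).trans (iff_of_eq ?_)
    congr 1
    funext i
    refine Fin.lastCases ?_ (fun i => ?_) i <;> simp
  | lfp r φ x ih =>
    intro P' N' m' f g h ρ η v
    refine forall_congr' fun T => imp_congr_left (forall_congr' fun y => imp_congr_left ?_)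
    refine (ih ..).trans (iff_of_eq ?_)
    congr 1
    · funext s X
      cases X <;> rfl
    · funext i
      refine Fin.addCases (fun i => ?_) (fun i => ?_) i <;> simp

variable {P N : List ℕ} {m : ℕ}

/-- Disjunction. -/
def or (φ ψ : LFPFormula P N m) : LFPFormula P N m := .neg (.and (.neg φ) (.neg ψ))

/-- Universal quantification. -/
def all (φ : LFPFormula P N (m + 1)) : LFPFormula P N m := .neg (.ex (.neg φ))

/-- Existential quantification over a tuple. -/
def exs : (r : ℕ) → LFPFormula P N (m + r) → LFPFormula P N m
  | 0, φ => φ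
  | r + 1, φ => exs r (.ex φ)

variable {n : ℕ} (G : DoubleDigraph n) (ρ : RelEnv (Fin n) P) (η : RelEnv (Fin n) N)
  (v : Fin m → Fin n)

theorem sat_or (φ ψ : LFPFormula P N m) :
    (φ.or ψ).Sat G ρ η v ↔ φ.Sat G ρ η v ∨ ψ.Sat G ρ η v := by
  simp only [or, Sat]; tauto

theorem sat_all (φ : LFPFormula P N (m + 1)) :
    φ.all.Sat G ρ η v ↔ ∀ b, φ.Sat G ρ η (Fin.snoc v b) := by
  simp [all, Sat]

theorem sat_exs (r : ℕ) (φ : LFPFormula P N (m + r)) :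
    (exs r φ).Sat G ρ η v ↔ ∃ y : Fin r → Fin n, φ.Sat G ρ η (Fin.append v y) := by
  induction r with
  | zero =>
    have h : ∀ y : Fin 0 → Fin n, Fin.append v y = v := fun y => by
      rw [Subsingleton.elim y Fin.elim0, Fin.append_elim0]; rfl
    simp only [h, exs]
    exact ⟨fun h => ⟨Fin.elim0, h⟩, fun ⟨_, h⟩ => h⟩
  | succ r ih =>
    simp only [exs, ih, Sat]
    constructor
    · rintro ⟨y, b, h⟩
      exact ⟨Fin.snoc y b, by rwa [Fin.append_snoc]⟩
    · rintro ⟨y, h⟩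
      refine ⟨Fin.init y, y (Fin.last r), ?_⟩
      rwa [← Fin.append_snoc, Fin.snoc_init_self]

end LFPFormula

namespace inductiveLogic

variable {r s : ℕ} {Q Q' : Query r}

theorem congr (h : inductiveLogic r Q) (e : ∀ n G v, Q' n G v ↔ Q n G v) :
    inductiveLogic r Q' := by
  obtain ⟨φ, hφ⟩ := h
  exact ⟨φ, fun n G x => (hφ n G x).trans (e n G x).symm⟩

theorem comp (h : inductiveLogic r Q) (f : Fin r → Fin s) :
    inductiveLogic s fun n G v => Q n G fun i => v (f i) := by
  obtain ⟨φ, hφ⟩ := h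
  refine ⟨φ.map (fun _ X => X) (fun _ X => X) f, fun n G x => ?_⟩
  rw [LFPFormula.sat_map]
  exact hφ _ _ _

theorem eq (i j : Fin r) : inductiveLogic r fun _ _ v => v i = v j :=
  ⟨.eq i j, fun _ _ _ => Iff.rfl⟩

theorem not (h : inductiveLogic r Q) : inductiveLogic r fun n G v => ¬ Q n G v := by
  obtain ⟨φ, hφ⟩ := h
  exact ⟨.neg φ, fun n G x => not_congr (hφ n G x)⟩

theorem and (h : inductiveLogic r Q) (h' : inductiveLogic r Q') :
    inductiveLogic r fun n G v => Q n G v ∧ Q' n G v := by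
  obtain ⟨φ, hφ⟩ := h
  obtain ⟨ψ, hψ⟩ := h'
  exact ⟨.and φ ψ, fun n G x => and_congr (hφ n G x) (hψ n G x)⟩

theorem or (h : inductiveLogic r Q) (h' : inductiveLogic r Q') :
    inductiveLogic r fun n G v => Q n G v ∨ Q' n G v :=
  (h.not.and h'.not).not.congr fun n G v => by tauto

theorem exs {Q : Query (s + r)} (h : inductiveLogic (s + r) Q) :
    inductiveLogic s fun n G v => ∃ y : Fin r → Fin n, Q n G (Fin.append v y) := by
  obtain ⟨φ, hφ⟩ := h
  exact ⟨.exs r φ, fun n G x => by simp only [LFPFormula.sat_exs, hφ]⟩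

theorem ex {Q : Query (r + 1)} (h : inductiveLogic (r + 1) Q) :
    inductiveLogic r fun n G v => ∃ b : Fin n, Q n G (Fin.snoc v b) := by
  obtain ⟨φ, hφ⟩ := h
  exact ⟨.ex φ, fun n G x => exists_congr fun b => hφ _ _ _⟩

theorem all {Q : Query (r + 1)} (h : inductiveLogic (r + 1) Q) :
    inductiveLogic r fun n G v => ∀ b : Fin n, Q n G (Fin.snoc v b) :=
  h.not.ex.not.congr fun n G v => by simp

/-- Inductive logic is closed under linear recursion. -/
theorem lfp {B : Query r} {C : Query (r + r)} (hB : inductiveLogic r B)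
    (hC : inductiveLogic (r + r) C) :
    inductiveLogic r fun n G x => ∀ T : (Fin r → Fin n) → Prop,
      (∀ x, B n G x → T x) → (∀ x y, T y → C n G (Fin.append x y) → T x) → T x := by
  obtain ⟨β, hβ⟩ := hB
  obtain ⟨γ, hγ⟩ := hC
  let up : ∀ {Γ : List ℕ} (s : ℕ), RelVar [] s → RelVar Γ s := fun s X => nomatch X
  -- The body has three blocks of `r` variables: the outer arguments, which it ignores, the tuple
  -- bound by the fixed point, and the quantified predecessor. The recursion variable is applied
  -- only to the last block; `id` evaluates the fixed point at the outer arguments.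
  refine ⟨.lfp r (.or (β.map up up (Fin.natAdd r)) (.exs r (.and
    (γ.map up up (Fin.append (fun i => (Fin.natAdd r i).castAdd r) (Fin.natAdd (r + r))))
    (.rvar .here (Fin.natAdd (r + r)))))) id, fun n G x => ?_⟩
  have nil (Γ : List ℕ) (ρ : RelEnv (Fin n) Γ) : (fun s X => ρ s (up s X)) = RelEnv.nil :=
    funext fun s => funext fun X => nomatch X
  simp only [LFPFormula.Sat, LFPFormula.sat_or, LFPFormula.sat_exs, LFPFormula.sat_map, nil, hβ, hγ]
  have e (x y z : Fin r → Fin n) : (fun i => Fin.append (Fin.append x y) z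
      (Fin.append (fun i => (Fin.natAdd r i).castAdd r) (Fin.natAdd (r + r)) i)) =
      Fin.append y z := by
    funext i
    refine Fin.addCases (fun i => ?_) (fun i => ?_) i <;>
      simp only [Fin.append_left, Fin.append_right]
  simp only [e, Fin.append_right, RelEnv.cons, id]
  refine forall_congr' fun T => ⟨fun h h₁ h₂ => h fun y => ?_, fun h h₁ => h ?_ ?_⟩
  · rintro (hy | ⟨z, hz, hT⟩)
    · exact h₁ _ hy
    · exact h₂ _ _ hT hz
  · exact fun y hy => h₁ y (Or.inl hy)
  · exact fun y z hz hy => h₁ y (Or.inr ⟨z, hy, hz⟩)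

end inductiveLogic

/-! ### Layers and heights -/

namespace DoubleDigraph

variable {n : ℕ} (G : DoubleDigraph n) (a : Fin n)

theorem mem_exits {i : Fin 2} {S U : Finset (Fin n)} {b : Fin n} :
    b ∈ G.exits i S U ↔ b ∉ U ∧ ∃ c ∈ S, G.R i c b := by
  simp [exits]

/-- The case distinction becomes a disjunction: any `R₁`-exit refutes the universal clause, and if
there is none the first disjunct fails. This is the form that the stage comparison translates. -/
theorem mem_next {S U : Finset (Fin n)} {b : Fin n} :
    b ∈ G.next S U ↔ b ∉ U ∧ ((∃ c ∈ S, G.R 0 c b) ∨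
      (∃ c ∈ S, G.R 1 c b) ∧ ∀ d ∈ S, ∀ e, G.R 0 d e → e ∈ U) := by
  unfold next
  split_ifs with h
  · obtain ⟨e, he⟩ := h
    obtain ⟨heU, d, hd, hde⟩ := G.mem_exits.1 he
    rw [mem_exits]
    exact and_congr_right fun _ => ⟨Or.inl, fun h => h.resolve_right fun h => heU (h.2 d hd e hde)⟩
  · have h' : ∀ d ∈ S, ∀ e, G.R 0 d e → e ∈ U := fun d hd e hde => by
      by_contra he
      exact h ⟨e, G.mem_exits.2 ⟨he, d, hd, hde⟩⟩
    rw [mem_exits]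
    refine and_congr_right fun hb => ⟨fun h => Or.inr ⟨h, h'⟩, ?_⟩
    rintro (⟨c, hc, hcb⟩ | h)
    · exact absurd (h' c hc b hcb) hb
    · exact h.1

theorem layer_zero : G.layer a 0 = {a} := by rw [layer]

theorem layer_succ (k : ℕ) : G.layer a (k + 1) =
    G.next (G.layer a k) (Finset.univ.biUnion fun m : Fin (k + 1) => G.layer a m) := by
  rw [layer]

theorem mem_used {k : ℕ} {b : Fin n} :
    b ∈ (Finset.univ.biUnion fun m : Fin (k + 1) => G.layer a m) ↔ ∃ m ≤ k, b ∈ G.layer a m := by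
  simp only [Finset.mem_biUnion, Finset.mem_univ, true_and]
  exact ⟨fun ⟨m, h⟩ => ⟨m, Nat.lt_succ_iff.1 m.2, h⟩, fun ⟨m, hm, h⟩ => ⟨⟨m, by omega⟩, h⟩⟩

theorem mem_layer_succ {k : ℕ} {b : Fin n} :
    b ∈ G.layer a (k + 1) ↔ (¬ ∃ m ≤ k, b ∈ G.layer a m) ∧ ((∃ c ∈ G.layer a k, G.R 0 c b) ∨
      (∃ c ∈ G.layer a k, G.R 1 c b) ∧
        ∀ d ∈ G.layer a k, ∀ e, G.R 0 d e → ∃ m ≤ k, e ∈ G.layer a m) := by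
  simp only [layer_succ, mem_next, mem_used]

variable {G a}

/-- Each layer avoids all earlier ones, so the level of a node from `a` is well defined. -/
theorem layer_unique {b : Fin n} {i j : ℕ} (hi : b ∈ G.layer a i) (hj : b ∈ G.layer a j) :
    i = j := by
  have key : ∀ i j, b ∈ G.layer a i → b ∈ G.layer a j → ¬ i < j := fun i j hi hj hij => by
    obtain ⟨k, rfl⟩ := Nat.exists_eq_succ_of_ne_zero (by omega : j ≠ 0)
    exact ((G.mem_layer_succ a).1 hj).1 ⟨i, by omega, hi⟩
  exact le_antisymm (not_lt.1 (key j i hj hi)) (not_lt.1 (key i j hi hj))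

theorem exists_mem_layer_of_mem_succ {b : Fin n} {k : ℕ} (h : b ∈ G.layer a (k + 1)) :
    ∃ c, c ∈ G.layer a k := by
  rcases ((G.mem_layer_succ a).1 h).2 with ⟨c, hc, -⟩ | ⟨⟨c, hc, -⟩, -⟩ <;> exact ⟨c, hc⟩

theorem exists_mem_layer_of_le {j k : ℕ} (hjk : j ≤ k) (h : ∃ b, b ∈ G.layer a k) :
    ∃ c, c ∈ G.layer a j := by
  induction k, hjk using Nat.le_induction with
  | base => exact h
  | succ k _ ih => exact ih (h.elim fun _ => exists_mem_layer_of_mem_succ)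

theorem mem_layer_zero {b : Fin n} : b ∈ G.layer a 0 ↔ b = a := by
  rw [layer_zero, Finset.mem_singleton]

/-- Choosing one node in each of the disjoint layers `0, …, k` gives `k + 1` different nodes. -/
theorem lt_of_mem_layer {b : Fin n} {k : ℕ} (h : b ∈ G.layer a k) : k < n := by
  choose f hf using fun j : Fin (k + 1) =>
    exists_mem_layer_of_le (Nat.lt_succ_iff.1 j.2) ⟨b, h⟩
  have hinj : Function.Injective f := fun i j hij =>
    Fin.ext (layer_unique (hf i) (hij ▸ hf j))
  simpa using Fintype.card_le_of_injective f hinj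

theorem stopsAt_iff {k : ℕ} : G.StopsAt a k ↔ ¬ ∃ b, b ∈ G.layer a (k + 1) := by
  constructor
  · rintro h ⟨b, hb⟩
    obtain ⟨h₁, ⟨c, hc, hcb⟩ | ⟨⟨c, hc, hcb⟩, -⟩⟩ := (G.mem_layer_succ a).1 hb <;>
      exact h₁ (h _ c hc b hcb)
  · intro h
    have h₀ : ∀ d ∈ G.layer a k, ∀ e, G.R 0 d e → ∃ m ≤ k, e ∈ G.layer a m :=
      fun d hd e hde => by
        by_contra he
        exact h ⟨e, (G.mem_layer_succ a).2 ⟨he, Or.inl ⟨d, hd, hde⟩⟩⟩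
    intro i c hc b hcb
    by_contra hb
    have : i = 0 ∨ i = 1 := by omega
    rcases this with rfl | rfl
    · exact hb (h₀ c hc b hcb)
    · exact h ⟨b, (G.mem_layer_succ a).2 ⟨hb, Or.inr ⟨⟨c, hc, hcb⟩, h₀⟩⟩⟩

/-- Nonempty layers form an initial segment, and stopping at `k` means that layer `k + 1` is empty;
the infimum is therefore the last inhabited level. -/
theorem exists_mem_layer_iff {k : ℕ} : (∃ b, b ∈ G.layer a k) ↔ k ≤ G.heightAt a := by
  have hne : {k | G.StopsAt a k}.Nonempty :=
    ⟨n, stopsAt_iff.2 fun ⟨b, hb⟩ => by have := lt_of_mem_layer hb; omega⟩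
  constructor
  · refine fun h => le_csInf hne fun m hm => ?_
    by_contra hlt
    exact stopsAt_iff.1 hm (exists_mem_layer_of_le (by omega : m + 1 ≤ k) h)
  · intro h
    obtain rfl | ⟨m, rfl⟩ : k = 0 ∨ ∃ m, k = m + 1 := by
      cases k <;> simp
    · exact ⟨a, mem_layer_zero.2 rfl⟩
    · by_contra hm
      have := Nat.sInf_le (show m ∈ {k | G.StopsAt a k} from stopsAt_iff.2 hm)
      unfold heightAt at h
      omega

theorem le_height_of_mem {b : Fin n} {k : ℕ} (h : b ∈ G.layer a k) : k ≤ G.height :=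
  (exists_mem_layer_iff.1 ⟨b, h⟩).trans
    (Finset.le_sup (f := fun a => G.heightAt a) (Finset.mem_univ a))

theorem exists_mem_layer_of_le_height (hn : 1 ≤ n) {k : ℕ} (h : k ≤ G.height) :
    ∃ a b, b ∈ G.layer a k := by
  have : Nonempty (Fin n) := ⟨⟨0, hn⟩⟩
  obtain ⟨a, -, ha⟩ := Finset.exists_mem_eq_sup Finset.univ Finset.univ_nonempty
    fun a => G.heightAt a
  obtain ⟨b, hb⟩ := exists_mem_layer_iff.2 (h.trans ha.le)
  exact ⟨a, b, hb⟩

theorem height_le : G.height ≤ n := by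
  refine Finset.sup_le fun a _ => ?_
  obtain ⟨b, hb⟩ := (exists_mem_layer_iff (G := G) (a := a)).2 le_rfl
  exact (lt_of_mem_layer hb).le

end DoubleDigraph

/-! ### Comparing the levels of two nodes by a least fixed point -/

/-- The relation of all `(a, c, x)` such that `c` has a level from `a` and `x` is not at a smaller
level. -/
def notBefore : Query 3 := fun _ G v =>
  ∃ i, v 1 ∈ G.layer (v 0) i ∧ ¬ ∃ m < i, v 2 ∈ G.layer (v 0) m

/-- The relation of all `(a, c, x)` such that `c` has a level from `a` and `x` is not at a smaller
level or at the same one. -/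
def before : Query 3 := fun _ G v =>
  ∃ i, v 1 ∈ G.layer (v 0) i ∧ ¬ ∃ m ≤ i, v 2 ∈ G.layer (v 0) m

namespace DoubleDigraph

variable {n : ℕ} (G : DoubleDigraph n) (a : Fin n)

/-- Membership in the layer after that of `c`, in terms of (approximations to) the relations
`notBefore` and `before`, which occur positively. -/
def Next (le lt : Fin n → Fin n → Prop) (c b : Fin n) : Prop :=
  lt c b ∧ ((∃ d, (le c d ∧ le d c) ∧ G.R 0 d b) ∨ (∃ d, (le c d ∧ le d c) ∧ G.R 1 d b) ∧
    ∀ d e, (lt c d ∨ lt d c) ∨ ¬ G.R 0 d e ∨ le e c)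

/-- Non-membership in the layer after that of `c`, in terms of (approximations to) the relations
`notBefore` and `before`, which occur positively. -/
def NotNext (le lt : Fin n → Fin n → Prop) (c b : Fin n) : Prop :=
  le b c ∨ (∀ d, (lt c d ∨ lt d c) ∨ ¬ G.R 0 d b) ∧
    ((∀ d, (lt c d ∨ lt d c) ∨ ¬ G.R 1 d b) ∨ ∃ d e, (le c d ∧ le d c) ∧ G.R 0 d e ∧ lt c e)

variable {G}

/-- Positivity is what the leastness proof needs: there the recursion variable is only known to
contain the comparison up to some level. -/
theorem Next.mono {le lt le' lt' : Fin n → Fin n → Prop} (hle : ∀ x y, le x y → le' x y)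
    (hlt : ∀ x y, lt x y → lt' x y) {c b : Fin n} (h : G.Next le lt c b) :
    G.Next le' lt' c b := by
  obtain ⟨h₁, h₂⟩ := h
  refine ⟨hlt _ _ h₁, h₂.imp ?_ ?_⟩
  · exact fun ⟨d, h, h'⟩ => ⟨d, h.imp (hle _ _) (hle _ _), h'⟩
  · exact And.imp (fun ⟨d, h, h'⟩ => ⟨d, h.imp (hle _ _) (hle _ _), h'⟩)
      fun h d e => (h d e).imp (Or.imp (hlt _ _) (hlt _ _)) (Or.imp_right (hle _ _))

theorem NotNext.mono {le lt le' lt' : Fin n → Fin n → Prop} (hle : ∀ x y, le x y → le' x y)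
    (hlt : ∀ x y, lt x y → lt' x y) {c b : Fin n} (h : G.NotNext le lt c b) :
    G.NotNext le' lt' c b := by
  refine h.imp (hle _ _) (And.imp ?_ (Or.imp ?_ ?_))
  · exact fun h d => (h d).imp_left (Or.imp (hlt _ _) (hlt _ _))
  · exact fun h d => (h d).imp_left (Or.imp (hlt _ _) (hlt _ _))
  · exact fun ⟨d, e, h, h', h''⟩ => ⟨d, e, h.imp (hle _ _) (hle _ _), h', hlt _ _ h''⟩

variable (G)

/-- The part of `notBefore` where the level of the first node satisfies `p`. -/
def LevelLE (p : ℕ → Prop) (c x : Fin n) : Prop :=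
  ∃ i, p i ∧ c ∈ G.layer a i ∧ ¬ ∃ m < i, x ∈ G.layer a m

/-- The part of `before` where the level of the first node satisfies `p`. -/
def LevelLT (p : ℕ → Prop) (c x : Fin n) : Prop :=
  ∃ i, p i ∧ c ∈ G.layer a i ∧ ¬ ∃ m ≤ i, x ∈ G.layer a m

variable {G a} {p : ℕ → Prop} {c x : Fin n} {i : ℕ}

theorem levelLE_left (hp : ∀ j ≤ i, p j) (hc : c ∈ G.layer a i) :
    G.LevelLE a p c x ↔ ¬ ∃ m < i, x ∈ G.layer a m :=
  ⟨fun ⟨_, _, hj, h⟩ => layer_unique hc hj ▸ h, fun h => ⟨i, hp i le_rfl, hc, h⟩⟩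

theorem levelLT_left (hp : ∀ j ≤ i, p j) (hc : c ∈ G.layer a i) :
    G.LevelLT a p c x ↔ ¬ ∃ m ≤ i, x ∈ G.layer a m :=
  ⟨fun ⟨_, _, hj, h⟩ => layer_unique hc hj ▸ h, fun h => ⟨i, hp i le_rfl, hc, h⟩⟩

/-- A known level for the second node turns "not earlier" into actual membership at a bounded level.
So the two comparisons, used in both directions, express membership and non-membership without
negation. -/
theorem levelLE_right (hp : ∀ j ≤ i, p j) (hc : c ∈ G.layer a i) :
    G.LevelLE a p x c ↔ ∃ m ≤ i, x ∈ G.layer a m := by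
  constructor
  · rintro ⟨j, -, hj, h⟩
    exact ⟨j, not_lt.1 fun h' => h ⟨i, h', hc⟩, hj⟩
  · rintro ⟨j, hji, hj⟩
    refine ⟨j, hp j hji, hj, fun ⟨m, hm, h⟩ => ?_⟩
    have := layer_unique hc h
    omega

theorem levelLT_right (hp : ∀ j ≤ i, p j) (hc : c ∈ G.layer a i) :
    G.LevelLT a p x c ↔ ∃ m < i, x ∈ G.layer a m := by
  constructor
  · rintro ⟨j, -, hj, h⟩
    exact ⟨j, not_le.1 fun h' => h ⟨i, h', hc⟩, hj⟩
  · rintro ⟨j, hji, hj⟩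
    refine ⟨j, hp j hji.le, hj, fun ⟨m, hm, h⟩ => ?_⟩
    have := layer_unique hc h
    omega

theorem same_level (hp : ∀ j ≤ i, p j) (hc : c ∈ G.layer a i) :
    (G.LevelLE a p c x ∧ G.LevelLE a p x c) ↔ x ∈ G.layer a i := by
  rw [levelLE_left hp hc, levelLE_right hp hc]
  constructor
  · rintro ⟨h, m, hm, hx⟩
    rcases hm.lt_or_eq with hm | rfl
    · exact absurd ⟨m, hm, hx⟩ h
    · exact hx
  · refine fun hx => ⟨fun ⟨m, hm, h⟩ => ?_, i, le_rfl, hx⟩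
    have := layer_unique hx h
    omega

theorem not_same_level (hp : ∀ j ≤ i, p j) (hc : c ∈ G.layer a i) :
    (G.LevelLT a p c x ∨ G.LevelLT a p x c) ↔ x ∉ G.layer a i := by
  rw [levelLT_left hp hc, levelLT_right hp hc, ← same_level hp hc, levelLE_left hp hc,
    levelLE_right hp hc, not_and_or, not_not, or_comm]

/-- Only levels up to that of `c` are consulted, so it suffices that `p` holds there. This covers
both the full comparison and the part of it available in an induction on levels. -/
theorem next_iff (hp : ∀ j ≤ i, p j) (hc : c ∈ G.layer a i) :
    G.Next (G.LevelLE a p) (G.LevelLT a p) c x ↔ x ∈ G.layer a (i + 1) := by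
  simp only [Next, same_level hp hc, not_same_level hp hc]
  simp only [levelLT_left hp hc, levelLE_right hp hc, mem_layer_succ]
  refine and_congr_right fun _ => or_congr Iff.rfl (and_congr_right fun _ =>
    forall_congr' fun d => ⟨fun h hd e => ?_, fun h e => ?_⟩)
  · have := h e; tauto
  · by_cases hd : d ∈ G.layer a i
    · have := h hd e; tauto
    · exact Or.inl hd

theorem notNext_iff (hp : ∀ j ≤ i, p j) (hc : c ∈ G.layer a i) :
    G.NotNext (G.LevelLE a p) (G.LevelLT a p) c x ↔ x ∉ G.layer a (i + 1) := by
  simp only [NotNext, same_level hp hc, not_same_level hp hc]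
  simp only [levelLT_left hp hc, levelLE_right hp hc, mem_layer_succ, not_and_or, not_not, not_or]
  refine or_congr Iff.rfl (and_congr ?_ (or_congr ?_ ?_))
  · push Not; exact forall_congr' fun d => by tauto
  · push Not; exact forall_congr' fun d => by tauto
  · push Not; simp only [exists_and_left]

end DoubleDigraph

namespace LevelFormula

variable {m : ℕ}

/-- The formula for `notBefore`, in terms of the relation variable. -/
def le {N : List ℕ} (c x : Fin m) : LFPFormula [3] N m := .rvar .here ![c, x, c]

/-- The formula for `before`, in terms of the relation variable. -/
def lt (c x : Fin m) : LFPFormula [3] [] m := .and (.neg (.eq c x)) (.rvar .here ![c, x, x])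

/-- The formula saying that `c` and `d` are at the same level. -/
def same (c d : Fin m) : LFPFormula [3] [] m := .and (le c d) (le d c)

/-- The formula saying that `c` and `d` are at different levels. -/
def diff (c d : Fin m) : LFPFormula [3] [] m := .or (lt c d) (lt d c)

/-- The formula for `DoubleDigraph.Next`. -/
def next (c b : Fin m) : LFPFormula [3] [] m :=
  .and (lt c b) (.or
    (.ex (.and (same c.castSucc (Fin.last _)) (.edge 0 (Fin.last _) b.castSucc)))
    (.and (.ex (.and (same c.castSucc (Fin.last _)) (.edge 1 (Fin.last _) b.castSucc)))
      (.all (.all (.or (diff c.castSucc.castSucc (Fin.last _).castSucc)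
        (.or (.neg (.edge 0 (Fin.last _).castSucc (Fin.last _)))
          (le (Fin.last _) c.castSucc.castSucc)))))))

/-- The formula for `DoubleDigraph.NotNext`. -/
def notNext (c b : Fin m) : LFPFormula [3] [] m :=
  .or (le b c) (.and
    (.all (.or (diff c.castSucc (Fin.last _)) (.neg (.edge 0 (Fin.last _) b.castSucc))))
    (.or (.all (.or (diff c.castSucc (Fin.last _)) (.neg (.edge 1 (Fin.last _) b.castSucc))))
      (.ex (.ex (.and (same c.castSucc.castSucc (Fin.last _).castSucc)
        (.and (.edge 0 (Fin.last _).castSucc (Fin.last _))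
          (lt c.castSucc.castSucc (Fin.last _))))))))

/-- The body of the recursion. The variables are `a`, `b`, `b'`, `t`; if `t` is `b`, the claim is
that `b'` is not at a smaller level than `b`, and otherwise that it is at no level up to that of
`b`. -/
def body : LFPFormula [3] [] (1 + 3) :=
  .or (.and (.eq 1 0) (.or (.eq 3 1) (.neg (.eq 2 0))))
    (.ex (.and (next 4 1) (.and (lt 4 2) (.or (.eq 3 1) (notNext 4 2)))))

variable {n : ℕ} (G : DoubleDigraph n) (T : (Fin 3 → Fin n) → Prop)
  (ρ : RelEnv (Fin n) []) (η : RelEnv (Fin n) []) (v : Fin m → Fin n)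

/-- The meaning of `le`. -/
def LE (c x : Fin n) : Prop := T ![c, x, c]

/-- The meaning of `lt`. -/
def LT (c x : Fin n) : Prop := c ≠ x ∧ T ![c, x, x]

theorem sat_le (c x : Fin m) : (le c x).Sat G (RelEnv.cons T ρ) η v ↔ LE T (v c) (v x) := by
  simp only [le, LFPFormula.Sat, RelEnv.cons, LE]
  refine iff_of_eq (congrArg T ?_)
  funext j; fin_cases j <;> rfl

theorem sat_lt (c x : Fin m) : (lt c x).Sat G (RelEnv.cons T ρ) η v ↔ LT T (v c) (v x) := by
  simp only [lt, LFPFormula.Sat, RelEnv.cons, LT]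
  refine and_congr Iff.rfl (iff_of_eq (congrArg T ?_))
  funext j; fin_cases j <;> rfl

theorem sat_next (c b : Fin m) :
    (next c b).Sat G (RelEnv.cons T ρ) η v ↔ G.Next (LE T) (LT T) (v c) (v b) := by
  simp only [next, LFPFormula.Sat, LFPFormula.sat_or, LFPFormula.sat_all, sat_le, sat_lt, same,
    diff, Fin.snoc_last, Fin.snoc_castSucc, DoubleDigraph.Next]

theorem sat_notNext (c b : Fin m) :
    (notNext c b).Sat G (RelEnv.cons T ρ) η v ↔ G.NotNext (LE T) (LT T) (v c) (v b) := by
  simp only [notNext, LFPFormula.Sat, LFPFormula.sat_or, LFPFormula.sat_all, sat_le, sat_lt, same,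
    diff, Fin.snoc_last, Fin.snoc_castSucc, DoubleDigraph.NotNext]

/-- The meaning of `body`. -/
theorem sat_body (x : Fin 1 → Fin n) (y : Fin 3 → Fin n) :
    body.Sat G (RelEnv.cons T ρ) η (Fin.append x y) ↔
      (y 0 = x 0 ∧ (y 2 = y 0 ∨ y 1 ≠ x 0)) ∨ ∃ c, G.Next (LE T) (LT T) c (y 0) ∧
        LT T c (y 1) ∧ (y 2 = y 0 ∨ G.NotNext (LE T) (LT T) c (y 1)) := by
  simp only [body, LFPFormula.Sat, LFPFormula.sat_or, sat_next, sat_lt, sat_notNext]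
  rfl

/-- The relation that is defined by recursion. -/
def target (a : Fin n) (y : Fin 3 → Fin n) : Prop :=
  ∃ i, y 0 ∈ G.layer a i ∧ ((y 2 = y 0 ∧ ¬ ∃ m < i, y 1 ∈ G.layer a m) ∨
    (y 2 ≠ y 0 ∧ ¬ ∃ m ≤ i, y 1 ∈ G.layer a m))

theorem le_target (a c x : Fin n) :
    LE (target G a) c x ↔ G.LevelLE a (fun _ => True) c x := by
  simp [LE, target, DoubleDigraph.LevelLE]

/-- A strict comparison forces `c ≠ x`, so `x` itself can serve as the third entry that differs from
`c`. -/
theorem lt_target (a c x : Fin n) :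
    LT (target G a) c x ↔ G.LevelLT a (fun _ => True) c x := by
  simp only [LT, target, DoubleDigraph.LevelLT, true_and, Matrix.cons_val]
  constructor
  · rintro ⟨hne, i, hi, ⟨h, -⟩ | ⟨-, h⟩⟩
    · exact absurd h.symm hne
    · exact ⟨i, hi, h⟩
  · rintro ⟨i, hi, h⟩
    have hne : c ≠ x := fun e => h ⟨i, le_rfl, e ▸ hi⟩
    exact ⟨hne, i, hi, Or.inr ⟨hne.symm, h⟩⟩

/-- One half of the fixed point computation: the second disjunct of the body moves from a node `c`
of level `i` to level `i + 1`, and being at no level up to `i + 1` splits into `lt` and `notNext`.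
-/
theorem target_closed (a : Fin n) (y : Fin 3 → Fin n)
    (h : body.Sat G (RelEnv.cons (target G a) ρ) η (Fin.append (fun _ => a) y)) :
    target G a y := by
  rw [sat_body] at h
  have e₁ : LE (target G a) = G.LevelLE a fun _ => True :=
    funext₂ fun c x => propext (le_target G a c x)
  have e₂ : LT (target G a) = G.LevelLT a fun _ => True :=
    funext₂ fun c x => propext (lt_target G a c x)
  rw [e₁, e₂] at h
  have hp : ∀ i : ℕ, ∀ j ≤ i, True := fun _ _ _ => trivial
  rcases h with ⟨h₁, h₂⟩ | ⟨c, h₁, h₂, h₃⟩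
  · refine ⟨0, DoubleDigraph.mem_layer_zero.2 h₁, ?_⟩
    by_cases h₃ : y 2 = y 0
    · exact Or.inl ⟨h₃, fun ⟨m, hm, _⟩ => absurd hm (by omega)⟩
    · refine Or.inr ⟨h₃, fun ⟨m, hm, h⟩ => ?_⟩
      obtain rfl : m = 0 := by omega
      exact (h₂.resolve_left h₃) (DoubleDigraph.mem_layer_zero.1 h)
  · obtain ⟨i, -, hc, hy⟩ := h₂
    rw [DoubleDigraph.next_iff (hp i) hc] at h₁
    rw [DoubleDigraph.notNext_iff (hp i) hc] at h₃
    refine ⟨i + 1, h₁, ?_⟩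
    by_cases h₄ : y 2 = y 0
    · exact Or.inl ⟨h₄, fun ⟨m, hm, h⟩ => hy ⟨m, by omega, h⟩⟩
    · refine Or.inr ⟨h₄, fun ⟨m, hm, h⟩ => ?_⟩
      rcases hm.lt_or_eq with hm | rfl
      · exact hy ⟨m, by omega, h⟩
      · exact (h₃.resolve_left h₄) h

/-- The other half, by induction on the level: a closed relation contains the comparison up to level
`i`, hence by monotonicity the exact instances of `next` and `notNext` that produce level `i + 1`.
-/
theorem target_least (a : Fin n) (hT : ∀ y : Fin 3 → Fin n,
    body.Sat G (RelEnv.cons T ρ) η (Fin.append (fun _ => a) y) → T y) (y : Fin 3 → Fin n)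
    (hy : target G a y) : T y := by
  simp only [sat_body] at hT
  obtain ⟨i, h₁, h₂⟩ := hy
  induction i using Nat.strong_induction_on generalizing y with
  | _ i ih =>
  refine hT y ?_
  rcases i with _ | i
  · refine Or.inl ⟨DoubleDigraph.mem_layer_zero.1 h₁, ?_⟩
    rcases h₂ with ⟨h, -⟩ | ⟨-, h⟩
    · exact Or.inl h
    · exact Or.inr fun e => h ⟨0, le_rfl, DoubleDigraph.mem_layer_zero.2 e⟩
  -- Any node of the preceding layer can be the witness `c`, since it is only used through its
  -- level.
  · obtain ⟨c, hc⟩ := DoubleDigraph.exists_mem_layer_of_mem_succ h₁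
    have hle : ∀ x z, G.LevelLE a (· ≤ i) x z → LE T x z := fun x z ⟨j, hj, hx, hz⟩ =>
      ih j (by omega) ![x, z, x] hx (Or.inl ⟨rfl, hz⟩)
    have hlt : ∀ x z, G.LevelLT a (· ≤ i) x z → LT T x z := fun x z ⟨j, hj, hx, hz⟩ => by
      have hne : x ≠ z := fun e => hz ⟨j, le_rfl, e ▸ hx⟩
      exact ⟨hne, ih j (by omega) ![x, z, z] hx (Or.inr ⟨hne.symm, hz⟩)⟩
    have hp : ∀ j ≤ i, j ≤ i := fun _ h => h
    refine Or.inr ⟨c, ((DoubleDigraph.next_iff hp hc).2 h₁).mono hle hlt,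
      hlt _ _ ((DoubleDigraph.levelLT_left hp hc).2 ?_), ?_⟩
    · rintro ⟨m, hm, h⟩
      rcases h₂ with ⟨-, h'⟩ | ⟨-, h'⟩
      · exact h' ⟨m, by omega, h⟩
      · exact h' ⟨m, by omega, h⟩
    · rcases h₂ with ⟨h, -⟩ | ⟨-, h⟩
      · exact Or.inl h
      · exact Or.inr (((DoubleDigraph.notNext_iff hp hc).2 fun h' =>
          h ⟨i + 1, le_rfl, h'⟩).mono hle hlt)

/-- The relation that is defined by recursion, with `a` as an argument. -/
theorem definable_target :
    inductiveLogic 4 fun _ G v => target G (v 0) ![v 1, v 2, v 3] := by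
  -- The root stays a parameter, read from the outer variable `0`, while the recursion runs over the
  -- variables `4, 5, 6`.
  refine ⟨.lfp 3 (body.map (fun _ X => X) (fun _ X => X) (![0, 4, 5, 6] : Fin 4 → Fin 7))
    ![1, 2, 3], fun n G v => ?_⟩
  have e : ∀ y : Fin 3 → Fin n, (fun i => (Fin.append v y : Fin 7 → Fin n)
      ((![0, 4, 5, 6] : Fin 4 → Fin 7) i)) = (Fin.append (fun _ : Fin 1 => v 0) y) := fun y => by
    funext i; fin_cases i <;> rfl
  have e' : (fun j => v ((![1, 2, 3] : Fin 3 → Fin 4) j)) = ![v 1, v 2, v 3] := by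
    funext i; fin_cases i <;> rfl
  simp only [LFPFormula.Sat, LFPFormula.sat_map, e']
  constructor
  · refine fun h => h _ fun y hy => ?_
    refine target_closed G RelEnv.nil RelEnv.nil (v 0) y ?_
    rw [← e]
    exact hy
  · refine fun h T hT => target_least G T RelEnv.nil RelEnv.nil (v 0) (fun y hy => hT y ?_) _ h
    rw [← e] at hy
    exact hy

end LevelFormula

theorem definable_notBefore : inductiveLogic 3 notBefore :=
  (LevelFormula.definable_target.comp ![0, 1, 2, 1]).congr fun _ G v =>
    (Iff.trans (by simp [notBefore, DoubleDigraph.LevelLE])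
      (LevelFormula.le_target G (v 0) (v 1) (v 2)).symm)

theorem definable_before : inductiveLogic 3 before :=
  ((inductiveLogic.eq 1 2).not.and (LevelFormula.definable_target.comp ![0, 1, 2, 2])).congr
    fun _ G v => (Iff.trans (by simp [before, DoubleDigraph.LevelLT])
      (LevelFormula.lt_target G (v 0) (v 1) (v 2)).symm)

/-! ### Arithmetic of levels in inductive logic -/

/-- The relation of all `(a, c, b)` such that `b` is one level above `c`, seen from `a`. -/
def nextLevel : Query 3 := fun _ G v =>
  ∃ k, v 1 ∈ G.layer (v 0) k ∧ v 2 ∈ G.layer (v 0) (k + 1)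

/-- The pairs `(a, b)` where `b` has a level from `a`. -/
def hasLevel : Query 2 := fun _ G v => ∃ k, v 1 ∈ G.layer (v 0) k

/-- Equality of levels. -/
def levelEq : Query 4 := fun _ G v =>
  ∃ k, v 1 ∈ G.layer (v 0) k ∧ v 3 ∈ G.layer (v 2) k

/-- The graph of the successor function on levels. -/
def levelSucc : Query 4 := fun _ G v =>
  ∃ k, v 1 ∈ G.layer (v 0) k ∧ v 3 ∈ G.layer (v 2) (k + 1)

/-- The graph of addition of levels. -/
def levelAdd : Query 6 := fun _ G v =>
  ∃ i j, v 1 ∈ G.layer (v 0) i ∧ v 3 ∈ G.layer (v 2) j ∧ v 5 ∈ G.layer (v 4) (i + j)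

/-- The graph of multiplication of levels. -/
def levelMul : Query 6 := fun _ G v =>
  ∃ i j, v 1 ∈ G.layer (v 0) i ∧ v 3 ∈ G.layer (v 2) j ∧ v 5 ∈ G.layer (v 4) (i * j)

/-- The graph of the `e`-th power function on levels. -/
def levelPow (e : ℕ) : Query 4 := fun _ G v =>
  ∃ i, v 1 ∈ G.layer (v 0) i ∧ v 3 ∈ G.layer (v 2) (i ^ e)

/-- The pairs of level `2 ^ 16 ^ i` for some `i`. -/
def levelTower : Query 2 := fun _ G v => ∃ i, v 1 ∈ G.layer (v 0) (2 ^ 16 ^ i)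

/-- The sentence saying that the height is in some interval `[2 ^ 16 ^ i, 2 ^ (4 * 16 ^ i))`. -/
def heightSentence : Query 0 := fun _ G _ =>
  ∃ i, 2 ^ 16 ^ i ≤ G.height ∧ G.height < 2 ^ (4 * 16 ^ i)

namespace inductiveLogic

open DoubleDigraph

/-- A node with a level is never strictly before itself, so comparing it with itself tests only that
the level exists. -/
theorem hasLevel : inductiveLogic 2 hasLevel :=
  (definable_notBefore.comp ![0, 1, 1]).congr fun n G v => by
    refine exists_congr fun k => (and_iff_left_of_imp ?_).symm
    rintro h ⟨m, hm, h'⟩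
    have := layer_unique h h'
    omega

/-- Immediate succession means that nothing lies strictly between; this is correct because every
level below an occurring one is inhabited. -/
theorem nextLevel : inductiveLogic 3 nextLevel := by
  refine ((((hasLevel.comp ![0, 2]).and (definable_before.comp ![0, 1, 2])).and
    (((definable_before.comp (![0, 1, 3] : Fin 3 → Fin 4)).not.or
      (definable_notBefore.comp ![0, 2, 3])).all))).congr fun n G v => ?_
  constructor
  · rintro ⟨k, h₁, h₂⟩
    refine ⟨⟨⟨k + 1, h₂⟩, k, h₁, ?_⟩, fun d => ?_⟩
    · rintro ⟨m, hm, h⟩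
      have := layer_unique h₂ h
      omega
    · by_cases h : ∃ m ≤ k, d ∈ G.layer (v 0) m
      · refine Or.inl ?_
        rintro ⟨k', h₁', h'⟩
        obtain rfl := layer_unique h₁ h₁'
        exact h' h
      · exact Or.inr ⟨k + 1, h₂, fun ⟨m, hm, h'⟩ => h ⟨m, by omega, h'⟩⟩
  · rintro ⟨⟨⟨l, h₁⟩, k, h₂, h₃⟩, h₄⟩
    have hkl : k < l := not_le.1 fun h => h₃ ⟨l, h, h₁⟩
    have h₂' : v 1 ∈ G.layer (v 0) k := h₂
    have h₁' : v 2 ∈ G.layer (v 0) l := h₁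
    obtain ⟨d, hd⟩ := exists_mem_layer_of_le (show k + 1 ≤ l by omega) ⟨_, h₁'⟩
    rcases h₄ d with h | ⟨l', hl', h⟩
    · refine absurd ⟨k, h₂', ?_⟩ h
      rintro ⟨m, hm, h⟩
      have := layer_unique hd h
      omega
    · obtain rfl := layer_unique h₁' hl'
      have : ¬ k + 1 < l := fun h' => h ⟨k + 1, h', hd⟩
      obtain rfl : l = k + 1 := by omega
      exact ⟨k, h₂', h₁'⟩

/-- The two explorations are run in parallel, with both roots fixed, from the roots upwards. -/
theorem levelEq : inductiveLogic 4 levelEq := by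
  have hB : inductiveLogic 4 fun _ _ v => v 1 = v 0 ∧ v 3 = v 2 := (eq 1 0).and (eq 3 2)
  have hC : inductiveLogic 8 fun n G v => (v 0 = v 4 ∧ v 2 = v 6) ∧
      _root_.nextLevel n G (fun i => v ((![0, 5, 1] : Fin 3 → Fin 8) i)) ∧
      _root_.nextLevel n G (fun i => v ((![2, 7, 3] : Fin 3 → Fin 8) i)) :=
    ((eq 0 4).and (eq 2 6)).and ((nextLevel.comp _).and (nextLevel.comp _))
  refine (lfp hB hC).congr fun n G v => ⟨?_, fun h => h (_root_.levelEq n G) ?_ ?_⟩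
  · rintro ⟨k, h₁, h₂⟩ T hT₁ hT₂
    induction k generalizing v with
    | zero => exact hT₁ v ⟨mem_layer_zero.1 h₁, mem_layer_zero.1 h₂⟩
    | succ k ih =>
      obtain ⟨c, hc⟩ := exists_mem_layer_of_mem_succ h₁
      obtain ⟨d, hd⟩ := exists_mem_layer_of_mem_succ h₂
      exact hT₂ v ![v 0, c, v 2, d] (ih _ hc hd) ⟨⟨rfl, rfl⟩, ⟨k, hc, h₁⟩, k, hd, h₂⟩
  · exact fun x ⟨h₁, h₂⟩ => ⟨0, mem_layer_zero.2 h₁, mem_layer_zero.2 h₂⟩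
  · rintro x y ⟨k, hk₁, hk₂⟩ ⟨⟨h₁, h₂⟩, ⟨i, hi₁, hi₂⟩, j, hj₁, hj₂⟩
    have h₁ : x 0 = y 0 := h₁
    have h₂ : x 2 = y 2 := h₂
    have hi₁ : y 1 ∈ G.layer (x 0) i := hi₁
    have hj₁ : y 3 ∈ G.layer (x 2) j := hj₁
    rw [← h₁] at hk₁
    rw [← h₂] at hk₂
    obtain rfl := layer_unique hk₁ hi₁
    obtain rfl := layer_unique hk₂ hj₁
    exact ⟨k + 1, hi₂, hj₂⟩

/-- The first level is copied to a node `c` seen from the second root, where two nodes can be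
compared directly. -/
theorem levelLE : inductiveLogic 4 levelLE := by
  have h : inductiveLogic 5 fun n G v =>
      _root_.levelEq n G (fun i => v ((![0, 1, 2, 4] : Fin 4 → Fin 5) i)) ∧
      notBefore n G (fun i => v ((![2, 4, 3] : Fin 3 → Fin 5) i)) ∧
      _root_.hasLevel n G (fun i => v ((![2, 3] : Fin 2 → Fin 5) i)) :=
    (levelEq.comp _).and ((definable_notBefore.comp _).and (hasLevel.comp _))
  refine h.ex.congr fun n G v => ⟨?_, ?_⟩
  · rintro ⟨i, j, h₁, h₂, hij⟩
    obtain ⟨c, hc⟩ := exists_mem_layer_of_le hij ⟨_, h₂⟩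
    refine ⟨c, ⟨i, h₁, hc⟩, ⟨i, hc, ?_⟩, j, h₂⟩
    rintro ⟨m, hm, h⟩
    have := layer_unique h₂ h
    omega
  · rintro ⟨c, ⟨i, h₁, hc⟩, ⟨i', hc', h⟩, j, h₂⟩
    obtain rfl := layer_unique hc hc'
    exact ⟨i, j, h₁, h₂, not_lt.1 fun hji => h ⟨j, hji, h₂⟩⟩

theorem levelSucc : inductiveLogic 4 levelSucc := by
  have h : inductiveLogic 5 fun n G v =>
      _root_.levelEq n G (fun i => v ((![0, 1, 2, 4] : Fin 4 → Fin 5) i)) ∧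
      _root_.nextLevel n G (fun i => v ((![2, 4, 3] : Fin 3 → Fin 5) i)) :=
    (levelEq.comp _).and (nextLevel.comp _)
  refine h.ex.congr fun n G v => ⟨?_, ?_⟩
  · rintro ⟨k, h₁, h₂⟩
    obtain ⟨c, hc⟩ := exists_mem_layer_of_mem_succ h₂
    exact ⟨c, ⟨k, h₁, hc⟩, k, hc, h₂⟩
  · rintro ⟨c, ⟨k, h₁, hc⟩, k', hc', h₂⟩
    obtain rfl := layer_unique hc hc'
    exact ⟨k, h₁, h₂⟩

/-- Recursion on the second summand. Only the first summand is frozen; the other pairs may change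
their roots, since `levelSucc` compares levels across roots. -/
theorem levelAdd : inductiveLogic 6 levelAdd := by
  have hB : inductiveLogic 6 fun n G v => v 3 = v 2 ∧
      _root_.levelEq n G (fun i => v ((![0, 1, 4, 5] : Fin 4 → Fin 6) i)) :=
    (eq 3 2).and (levelEq.comp _)
  have hC : inductiveLogic 12 fun n G v => (v 0 = v 6 ∧ v 1 = v 7) ∧
      _root_.levelSucc n G (fun i => v ((![8, 9, 2, 3] : Fin 4 → Fin 12) i)) ∧
      _root_.levelSucc n G (fun i => v ((![10, 11, 4, 5] : Fin 4 → Fin 12) i)) :=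
    ((eq 0 6).and (eq 1 7)).and ((levelSucc.comp _).and (levelSucc.comp _))
  refine (lfp hB hC).congr fun n G v => ⟨?_, fun h => h (_root_.levelAdd n G) ?_ ?_⟩
  · rintro ⟨i, j, h₁, h₂, h₃⟩ T hT₁ hT₂
    induction j generalizing v with
    | zero => exact hT₁ v ⟨mem_layer_zero.1 h₂, i, h₁, h₃⟩
    | succ j ih =>
      obtain ⟨c, hc⟩ := exists_mem_layer_of_mem_succ h₂
      obtain ⟨d, hd⟩ := exists_mem_layer_of_mem_succ h₃
      exact hT₂ v ![v 0, v 1, v 2, c, v 4, d] (ih _ h₁ hc hd)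
        ⟨⟨rfl, rfl⟩, ⟨j, hc, h₂⟩, i + j, hd, h₃⟩
  · exact fun x ⟨h₁, i, h₂, h₃⟩ => ⟨i, 0, h₂, mem_layer_zero.2 h₁, h₃⟩
  · rintro x y ⟨i, j, h₁, h₂, h₃⟩ ⟨⟨e₁, e₂⟩, ⟨k, hk₁, hk₂⟩, l, hl₁, hl₂⟩
    have e₁ : x 0 = y 0 := e₁
    have e₂ : x 1 = y 1 := e₂
    rw [← e₁, ← e₂] at h₁
    obtain rfl := layer_unique h₂ hk₁
    obtain rfl := layer_unique h₃ hl₁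
    exact ⟨i, j + 1, h₁, hk₂, hl₂⟩

/-- Recursion on the second factor by `i * (j + 1) = i * j + i`. The partial product is at most the
final one, so it is a level from the same root. -/
theorem levelMul : inductiveLogic 6 levelMul := by
  have hB : inductiveLogic 6 fun n G v => (v 3 = v 2 ∧ v 5 = v 4) ∧
      _root_.hasLevel n G (fun i => v ((![0, 1] : Fin 2 → Fin 6) i)) :=
    ((eq 3 2).and (eq 5 4)).and (hasLevel.comp _)
  have hC : inductiveLogic 12 fun n G v => (v 0 = v 6 ∧ v 1 = v 7) ∧
      _root_.levelSucc n G (fun i => v ((![8, 9, 2, 3] : Fin 4 → Fin 12) i)) ∧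
      _root_.levelAdd n G (fun i => v ((![10, 11, 0, 1, 4, 5] : Fin 6 → Fin 12) i)) :=
    ((eq 0 6).and (eq 1 7)).and ((levelSucc.comp _).and (levelAdd.comp _))
  refine (lfp hB hC).congr fun n G v => ⟨?_, fun h => h (_root_.levelMul n G) ?_ ?_⟩
  · rintro ⟨i, j, h₁, h₂, h₃⟩ T hT₁ hT₂
    induction j generalizing v with
    | zero => exact hT₁ v ⟨⟨mem_layer_zero.1 h₂, mem_layer_zero.1 h₃⟩, i, h₁⟩
    | succ j ih =>
      obtain ⟨c, hc⟩ := exists_mem_layer_of_mem_succ h₂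
      rw [Nat.mul_succ] at h₃
      obtain ⟨d, hd⟩ := exists_mem_layer_of_le (Nat.le_add_right (i * j) i) ⟨_, h₃⟩
      exact hT₂ v ![v 0, v 1, v 2, c, v 4, d] (ih _ h₁ hc hd)
        ⟨⟨rfl, rfl⟩, ⟨j, hc, h₂⟩, i * j, i, hd, h₁, h₃⟩
  · exact fun x ⟨⟨h₁, h₂⟩, i, h₃⟩ => ⟨i, 0, h₃, mem_layer_zero.2 h₁, mem_layer_zero.2 h₂⟩
  · rintro x y ⟨i, j, h₁, h₂, h₃⟩ ⟨⟨e₁, e₂⟩, ⟨k, hk₁, hk₂⟩, l, l', hl₁, hl₁', hl₂⟩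
    have e₁ : x 0 = y 0 := e₁
    have e₂ : x 1 = y 1 := e₂
    rw [← e₁, ← e₂] at h₁
    obtain rfl := layer_unique h₂ hk₁
    obtain rfl := layer_unique h₃ hl₁
    obtain rfl := layer_unique h₁ hl₁'
    exact ⟨i, j + 1, h₁, hk₂, hl₂⟩

theorem levelPow_two : inductiveLogic 4 (levelPow 2) :=
  (levelMul.comp ![0, 1, 0, 1, 2, 3]).congr fun n G v => ⟨
    fun ⟨i, h₁, h₂⟩ => ⟨i, i, h₁, h₁, sq i ▸ h₂⟩, fun ⟨i, j, h₁, h₂, h₃⟩ => by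
      obtain rfl := layer_unique h₁ h₂
      exact ⟨i, h₁, (sq i).symm ▸ h₃⟩⟩

/-- The intermediate power `i ^ d` must itself be a level; `e ≠ 0` makes it at most `i ^ (d * e)`.
-/
theorem levelPow_mul {d e : ℕ} (he : e ≠ 0) (h : inductiveLogic 4 (levelPow d))
    (h' : inductiveLogic 4 (levelPow e)) : inductiveLogic 4 (levelPow (d * e)) := by
  have h : inductiveLogic 6 fun n G v =>
      levelPow d n G (fun i => v ((![0, 1, 4, 5] : Fin 4 → Fin 6) i)) ∧
      levelPow e n G (fun i => v ((![4, 5, 2, 3] : Fin 4 → Fin 6) i)) :=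
    (h.comp _).and (h'.comp _)
  refine (exs (s := 4) (r := 2) h).congr fun n G v => ⟨?_, ?_⟩
  · rintro ⟨i, h₁, h₂⟩
    rw [pow_mul] at h₂
    obtain ⟨c, hc⟩ := exists_mem_layer_of_le (Nat.le_self_pow he (i ^ d)) ⟨_, h₂⟩
    exact ⟨![v 2, c], ⟨i, h₁, hc⟩, i ^ d, hc, h₂⟩
  · rintro ⟨y, ⟨i, h₁, h₂⟩, j, h₃, h₄⟩
    obtain rfl := layer_unique h₂ h₃
    rw [← pow_mul] at h₄
    exact ⟨i, h₁, h₄⟩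

theorem levelPow_four : inductiveLogic 4 (levelPow 4) :=
  levelPow_mul (d := 2) (e := 2) two_ne_zero levelPow_two levelPow_two

theorem levelPow_sixteen : inductiveLogic 4 (levelPow 16) :=
  levelPow_mul (d := 4) (e := 4) four_ne_zero levelPow_four levelPow_four

theorem levelTower : inductiveLogic 2 levelTower := by
  -- The base case is level `2 = 2 ^ 16 ^ 0`, two successor steps above the root; the recursion then
  -- takes 16th powers.
  have hB : inductiveLogic 3 fun n G v =>
      _root_.nextLevel n G (fun i => v ((![0, 0, 2] : Fin 3 → Fin 3) i)) ∧
      _root_.nextLevel n G (fun i => v ((![0, 2, 1] : Fin 3 → Fin 3) i)) :=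
    (nextLevel.comp _).and (nextLevel.comp _)
  have hC : inductiveLogic 4 fun n G v =>
      levelPow 16 n G (fun i => v ((![2, 3, 0, 1] : Fin 4 → Fin 4) i)) :=
    levelPow_sixteen.comp _
  refine (lfp (r := 2) hB.ex hC).congr fun n G v =>
    ⟨?_, fun h => h (_root_.levelTower n G) ?_ ?_⟩
  · rintro ⟨k, h₁⟩ T hT₁ hT₂
    induction k generalizing v with
    | zero =>
      obtain ⟨c, hc⟩ := exists_mem_layer_of_mem_succ h₁
      exact hT₁ v ⟨c, ⟨0, mem_layer_zero.2 rfl, hc⟩, 1, hc, h₁⟩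
    | succ k ih =>
      rw [pow_succ, pow_mul] at h₁
      obtain ⟨c, hc⟩ := exists_mem_layer_of_le
        (Nat.le_self_pow (by norm_num : 16 ≠ 0) (2 ^ 16 ^ k)) ⟨_, h₁⟩
      exact hT₂ v ![v 0, c] (ih _ hc) ⟨_, hc, h₁⟩
  · rintro x ⟨c, ⟨k, hk, h₁⟩, l, h₂, h₃⟩
    have hk' : x 0 ∈ G.layer (x 0) k := hk
    obtain rfl := layer_unique hk' (mem_layer_zero.2 rfl)
    obtain rfl := layer_unique h₂ h₁
    exact ⟨0, h₃⟩
  · rintro x y ⟨k, h₁⟩ ⟨i, h₂, h₃⟩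
    obtain rfl := layer_unique h₁ h₂
    refine ⟨k + 1, ?_⟩
    rw [pow_succ, pow_mul]
    exact h₃

/-- The upper bound on the height is the absence of any pair whose level is the fourth power of the
tower level. -/
theorem heightSentence : inductiveLogic 0 heightSentence := by
  have h : inductiveLogic 2 fun n G v => _root_.levelTower n G v ∧
      ¬ ∃ y : Fin 2 → Fin n, levelPow 4 n G (Fin.append v y) :=
    levelTower.and (exs (s := 2) (r := 2) levelPow_four).not
  have h' := h.comp (![0, 1] : Fin 2 → Fin (0 + 2))
  refine (exs (s := 0) (r := 2) h').congr fun n G v => ⟨?_, ?_⟩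
  · rintro ⟨i, h₁, h₂⟩
    have hn : 1 ≤ n := Nat.one_le_iff_ne_zero.2 fun h => by
      subst h
      have : G.height = 0 := by simp [height]
      exact absurd (this ▸ h₁) (by simp)
    obtain ⟨a, b, hb⟩ := exists_mem_layer_of_le_height hn h₁
    refine ⟨![a, b], ⟨i, hb⟩, ?_⟩
    rintro ⟨y, j, h₃, h₄⟩
    obtain rfl := layer_unique (show b ∈ G.layer a j from h₃) hb
    have := le_height_of_mem h₄
    rw [← pow_mul, mul_comm] at this
    omega
  · rintro ⟨y, ⟨i, h₁⟩, h₂⟩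
    refine ⟨i, le_height_of_mem h₁, ?_⟩
    by_contra h₃
    have hn : 1 ≤ n := Fin.pos (y 0)
    obtain ⟨a, b, hb⟩ := exists_mem_layer_of_le_height hn (not_lt.1 h₃)
    rw [mul_comm, pow_mul] at hb
    exact h₂ ⟨![a, b], _, h₁, hb⟩

end inductiveLogic

/-! ### Definability in infinitary logic -/

/-- Definability by a formula of `L_{∞,k}`, as a property of valuations of the `k` variables. -/
def InfDefinable (k : ℕ) (Q : ∀ n : ℕ, DoubleDigraph n → (Fin k → Fin n) → Prop) : Prop :=
  ∃ φ : InfFormula k, ∀ (n : ℕ) (G : DoubleDigraph n) (v : Fin k → Fin n), φ.Sat G v ↔ Q n G v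

namespace InfDefinable

open DoubleDigraph

variable {k : ℕ} {Q Q' : ∀ n : ℕ, DoubleDigraph n → (Fin k → Fin n) → Prop}

theorem congr (h : InfDefinable k Q) (e : ∀ n G v, Q' n G v ↔ Q n G v) : InfDefinable k Q' := by
  obtain ⟨φ, hφ⟩ := h
  exact ⟨φ, fun n G v => (hφ n G v).trans (e n G v).symm⟩

theorem eq (x y : Fin k) : InfDefinable k fun _ _ v => v x = v y :=
  ⟨.eq x y, fun _ _ _ => Iff.rfl⟩

theorem edge (i : Fin 2) (x y : Fin k) : InfDefinable k fun _ G v => G.R i (v x) (v y) :=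
  ⟨.edge i x y, fun _ _ _ => Iff.rfl⟩

theorem not (h : InfDefinable k Q) : InfDefinable k fun n G v => ¬ Q n G v := by
  obtain ⟨φ, hφ⟩ := h
  exact ⟨.neg φ, fun n G v => not_congr (hφ n G v)⟩

theorem forall' {I : Type} {Q : I → ∀ n : ℕ, DoubleDigraph n → (Fin k → Fin n) → Prop}
    (h : ∀ i, InfDefinable k (Q i)) : InfDefinable k fun n G v => ∀ i, Q i n G v := by
  choose φ hφ using h
  exact ⟨.conj I φ, fun n G v => forall_congr' fun i => hφ i n G v⟩

theorem exists' {I : Type} {Q : I → ∀ n : ℕ, DoubleDigraph n → (Fin k → Fin n) → Prop}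
    (h : ∀ i, InfDefinable k (Q i)) : InfDefinable k fun n G v => ∃ i, Q i n G v :=
  (forall' fun i => (h i).not).not.congr fun n G v => by simp

theorem and (h : InfDefinable k Q) (h' : InfDefinable k Q') :
    InfDefinable k fun n G v => Q n G v ∧ Q' n G v :=
  (forall' (Q := fun b : Bool => bif b then Q else Q') fun b => by cases b <;> assumption).congr
    fun n G v => by simp [and_comm]

theorem or (h : InfDefinable k Q) (h' : InfDefinable k Q') :
    InfDefinable k fun n G v => Q n G v ∨ Q' n G v :=
  (h.not.and h'.not).not.congr fun n G v => by tauto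

theorem ex (x : Fin k) (h : InfDefinable k Q) :
    InfDefinable k fun n G v => ∃ b : Fin n, Q n G (Function.update v x b) := by
  obtain ⟨φ, hφ⟩ := h
  exact ⟨.ex x φ, fun n G v => exists_congr fun b => hφ n G _⟩

/-- The induction is on `m` for all choices of the two free variables at once. The recursive
instances can then rename and requantify, and two auxiliary variables suffice for every `m`. -/
theorem layer (hk : 4 ≤ k) (m : ℕ) :
    ∀ x y : Fin k, InfDefinable k fun _ G v => v y ∈ G.layer (v x) m := by
  induction m using Nat.strong_induction_on with
  | _ m ih =>
  intro x y
  rcases m with _ | m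
  · exact (eq y x).congr fun n G v => mem_layer_zero
  have hfresh : ∀ s : Finset (Fin k), s.card < 4 → ∃ z, z ∉ s := fun s hs => by
    by_contra h
    push Not at h
    have := Finset.card_le_card (fun z _ => h z : (Finset.univ : Finset (Fin k)) ⊆ s)
    rw [Finset.card_univ, Fintype.card_fin] at this
    omega
  obtain ⟨z, hz⟩ := hfresh {x, y} (Finset.card_le_two.trans_lt (by norm_num))
  obtain ⟨w, hw⟩ := hfresh {x, y, z} (Finset.card_le_three.trans_lt (by norm_num))
  simp only [Finset.mem_insert, Finset.mem_singleton, not_or] at hz hw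
  have hm := ih m (by omega)
  have used (t : Fin k) : InfDefinable k fun n G v => ∃ l : Fin (m + 1), v t ∈ G.layer (v x) l :=
    exists' fun l => ih l l.2 x t
  have h₀ := ((hm x z).and (edge 0 z y)).ex z
  have h₁ := ((hm x z).and (edge 1 z y)).ex z
  have h₂ := ((((hm x z).and (edge 0 z w)).and (used w).not).ex w).ex z
  refine ((used y).not.and (h₀.or (h₁.and h₂.not))).congr fun n G v => ?_
  have used_iff (b : Fin n) : (∃ l : Fin (m + 1), b ∈ G.layer (v x) l) ↔
      ∃ l ≤ m, b ∈ G.layer (v x) l :=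
    ⟨fun ⟨l, h⟩ => ⟨l, by omega, h⟩, fun ⟨l, hl, h⟩ => ⟨⟨l, by omega⟩, h⟩⟩
  simp only [Function.update_self, Function.update_of_ne, ne_eq, Ne.symm hz.1, Ne.symm hz.2,
    Ne.symm hw.1, Ne.symm hw.2.2, not_false_eq_true, used_iff, mem_layer_succ]
  refine and_congr_right fun _ => or_congr Iff.rfl (and_congr_right fun _ => ?_)
  push Not
  exact ⟨fun h b c hb => h b hb.1 c hb.2, fun h b hb c hbc => h b c ⟨hb, hbc⟩⟩

theorem hasLayer (hk : 4 ≤ k) (m : ℕ) :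
    InfDefinable k fun n G _ => ∃ a b : Fin n, b ∈ G.layer a m := by
  refine (((layer hk m ⟨0, by omega⟩ ⟨1, by omega⟩).ex ⟨1, by omega⟩).ex ⟨0, by omega⟩).congr
    fun n G v => ?_
  simp

end InfDefinable

namespace infinitaryLogic

open DoubleDigraph

variable {k : ℕ}

theorem of_infDefinable {r : ℕ} {Q : Query r} (h : r ≤ k)
    (hQ : InfDefinable k fun n G v => Q n G fun j => v (Fin.castLE h j)) :
    infinitaryLogic k r Q := by
  obtain ⟨φ, hφ⟩ := hQ
  exact ⟨h, φ, hφ⟩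

theorem hasLevel (hk : 6 ≤ k) : infinitaryLogic k 2 hasLevel :=
  of_infDefinable (by omega) (InfDefinable.exists' fun i =>
    InfDefinable.layer (by omega) i (Fin.castLE _ 0) (Fin.castLE _ 1))

theorem levelEq (hk : 6 ≤ k) : infinitaryLogic k 4 levelEq :=
  of_infDefinable (by omega) (InfDefinable.exists' fun i =>
    (InfDefinable.layer (by omega) i (Fin.castLE _ 0) (Fin.castLE _ 1)).and
      (InfDefinable.layer (by omega) i (Fin.castLE _ 2) (Fin.castLE _ 3)))

theorem levelLE (hk : 6 ≤ k) : infinitaryLogic k 4 levelLE :=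
  of_infDefinable (by omega) ((InfDefinable.exists' fun p : {p : ℕ × ℕ // p.1 ≤ p.2} =>
    (InfDefinable.layer (by omega) p.1.1 (Fin.castLE _ 0) (Fin.castLE _ 1)).and
      (InfDefinable.layer (by omega) p.1.2 (Fin.castLE _ 2) (Fin.castLE _ 3))).congr
    fun n G v => ⟨fun ⟨i, j, h₁, h₂, h⟩ => ⟨⟨(i, j), h⟩, h₁, h₂⟩,
      fun ⟨⟨(i, j), h⟩, h₁, h₂⟩ => ⟨i, j, h₁, h₂, h⟩⟩)

theorem levelAdd (hk : 6 ≤ k) : infinitaryLogic k 6 levelAdd :=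
  of_infDefinable hk (InfDefinable.exists' fun i => InfDefinable.exists' fun j =>
    (InfDefinable.layer (by omega) i (Fin.castLE _ 0) (Fin.castLE _ 1)).and
      ((InfDefinable.layer (by omega) j (Fin.castLE _ 2) (Fin.castLE _ 3)).and
        (InfDefinable.layer (by omega) (i + j) (Fin.castLE _ 4) (Fin.castLE _ 5))))

theorem levelMul (hk : 6 ≤ k) : infinitaryLogic k 6 levelMul :=
  of_infDefinable hk (InfDefinable.exists' fun i => InfDefinable.exists' fun j =>
    (InfDefinable.layer (by omega) i (Fin.castLE _ 0) (Fin.castLE _ 1)).and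
      ((InfDefinable.layer (by omega) j (Fin.castLE _ 2) (Fin.castLE _ 3)).and
        (InfDefinable.layer (by omega) (i * j) (Fin.castLE _ 4) (Fin.castLE _ 5))))

theorem heightSentence (hk : 6 ≤ k) : infinitaryLogic k 0 heightSentence := by
  refine of_infDefinable (by omega) ((InfDefinable.exists' fun i : ℕ =>
    (InfDefinable.hasLayer (by omega) (2 ^ 16 ^ i)).and
      (InfDefinable.hasLayer (by omega) (2 ^ (4 * 16 ^ i))).not).congr
    fun n G v => exists_congr fun i => ?_)
  -- A valuation of at least one variable exists only when there is a node.
  have hn : 1 ≤ n := Fin.pos (v ⟨0, by omega⟩)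
  have key (m : ℕ) : (∃ a b : Fin n, b ∈ G.layer a m) ↔ m ≤ G.height :=
    ⟨fun ⟨_, _, h⟩ => le_height_of_mem h, exists_mem_layer_of_le_height hn⟩
  rw [key, key, not_le]

end infinitaryLogic

/-! ### The interpretation of arithmetic -/

/-- The interpretation of an initial segment of arithmetic by levels: the pair `(a, b)` stands for
the level of `b` from `a`. -/
def levelScheme : ArithScheme 2 where
  dom := hasLevel
  eq := levelEq
  le := levelLE
  add := levelAdd
  mul := levelMul

open DoubleDigraph in
theorem levelScheme_interprets {n : ℕ} (G : DoubleDigraph n) (hn : 1 ≤ n) :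
    levelScheme.Interprets G (G.height + 1) := by
  classical
  -- On the domain this is the unique level; elsewhere it is `0`, which plays no role.
  let f : (Fin 2 → Fin n) → ℕ := fun x => sInf {k | x 1 ∈ G.layer (x 0) k}
  have hf {x : Fin 2 → Fin n} {k : ℕ} (h : x 1 ∈ G.layer (x 0) k) : f x = k :=
    layer_unique (Nat.sInf_mem (s := {k | x 1 ∈ G.layer (x 0) k}) ⟨k, h⟩) h
  refine ⟨f, ?_, ?_, ?_⟩
  · ext m
    rw [Set.mem_Iio, Nat.lt_succ_iff]
    constructor
    · rintro ⟨x, ⟨k, hk⟩, rfl⟩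
      rw [hf hk]
      exact le_height_of_mem hk
    · intro hm
      obtain ⟨a, b, hb⟩ := exists_mem_layer_of_le_height hn hm
      exact ⟨![a, b], ⟨m, hb⟩, hf hb⟩
  · rintro x y ⟨i, hi⟩ ⟨j, hj⟩
    rw [hf hi, hf hj]
    constructor
    · constructor
      · rintro ⟨k, h₁, h₂⟩
        exact (layer_unique hi h₁).trans (layer_unique h₂ hj)
      · rintro rfl
        exact ⟨i, hi, hj⟩
    · constructor
      · rintro ⟨k, l, h₁, h₂, h⟩
        rwa [layer_unique hi h₁, layer_unique hj h₂]
      · exact fun h => ⟨i, j, hi, hj, h⟩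
  · rintro x y z ⟨i, hi⟩ ⟨j, hj⟩ ⟨k, hk⟩
    rw [hf hi, hf hj, hf hk]
    constructor
    · constructor
      · rintro ⟨i', j', h₁, h₂, h₃⟩
        obtain rfl := layer_unique hi h₁
        obtain rfl := layer_unique hj h₂
        exact layer_unique h₃ hk
      · rintro rfl
        exact ⟨i, j, hi, hj, hk⟩
    · constructor
      · rintro ⟨i', j', h₁, h₂, h₃⟩
        obtain rfl := layer_unique hi h₁
        obtain rfl := layer_unique hj h₂
        exact layer_unique h₃ hk
      · rintro rfl
        exact ⟨i, j, hi, hj, hk⟩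

noncomputable section

/-! ### Independent Boolean variables -/

section Bernoulli

variable {E : Type} [Fintype E] (q : E → ℝ)

/-- The weight of a family of Boolean values that are drawn independently. -/
def bernoulliWeight (G : E → Bool) : ℝ := ∏ e, if G e = true then q e else 1 - q e

variable {q} in
theorem bernoulliWeight_nonneg (h₀ : ∀ e, 0 ≤ q e) (h₁ : ∀ e, q e ≤ 1) (G : E → Bool) :
    0 ≤ bernoulliWeight q G :=
  Finset.prod_nonneg fun e _ => by
    split_ifs
    exacts [h₀ e, sub_nonneg.2 (h₁ e)]

variable [DecidableEq E]

open Classical in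
/-- The probability of an event when Boolean values are drawn independently. -/
def bernoulliProb (A : (E → Bool) → Prop) : ℝ := ∑ G, if A G then bernoulliWeight q G else 0

/-- Expectations of products factor over the independent coordinates. Total mass, the all-false
bound and the exponential moment are choices of `f`. -/
theorem sum_bernoulliWeight_mul_prod (f : E → Bool → ℝ) :
    ∑ G : E → Bool, bernoulliWeight q G * ∏ e, f e (G e) =
      ∏ e, (q e * f e true + (1 - q e) * f e false) := by
  have := (Finset.prod_univ_sum (fun _ : E => (Finset.univ : Finset Bool))
    fun e b => (if b = true then q e else 1 - q e) * f e b).symm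
  simp only [Fintype.piFinset_univ, Finset.prod_mul_distrib] at this
  simpa [bernoulliWeight] using this

theorem sum_bernoulliWeight : ∑ G : E → Bool, bernoulliWeight q G = 1 := by
  simpa using sum_bernoulliWeight_mul_prod q fun _ _ => 1

theorem bernoulliProb_add_not (A : (E → Bool) → Prop) :
    bernoulliProb q A + bernoulliProb q (fun G => ¬ A G) = 1 := by
  rw [bernoulliProb, bernoulliProb, ← Finset.sum_add_distrib, ← sum_bernoulliWeight q]
  refine Finset.sum_congr rfl fun G _ => ?_
  by_cases h : A G <;> simp [h]

variable {q}

theorem bernoulliProb_mono (h₀ : ∀ e, 0 ≤ q e) (h₁ : ∀ e, q e ≤ 1) {A B : (E → Bool) → Prop}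
    (h : ∀ G, A G → B G) : bernoulliProb q A ≤ bernoulliProb q B := by
  refine Finset.sum_le_sum fun G _ => ?_
  by_cases hA : A G
  · simp [hA, h G hA]
  · rw [if_neg hA]
    split_ifs
    exacts [bernoulliWeight_nonneg h₀ h₁ G, le_rfl]

theorem bernoulliProb_nonneg (h₀ : ∀ e, 0 ≤ q e) (h₁ : ∀ e, q e ≤ 1) (A : (E → Bool) → Prop) :
    0 ≤ bernoulliProb q A :=
  Finset.sum_nonneg fun G _ => by
    split_ifs
    exacts [bernoulliWeight_nonneg h₀ h₁ G, le_rfl]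

theorem bernoulliProb_or_le (h₀ : ∀ e, 0 ≤ q e) (h₁ : ∀ e, q e ≤ 1) (A B : (E → Bool) → Prop) :
    bernoulliProb q (fun G => A G ∨ B G) ≤ bernoulliProb q A + bernoulliProb q B := by
  rw [bernoulliProb, bernoulliProb, bernoulliProb, ← Finset.sum_add_distrib]
  refine Finset.sum_le_sum fun G _ => ?_
  have := bernoulliWeight_nonneg h₀ h₁ G
  by_cases hA : A G <;> by_cases hB : B G <;> simp [hA, hB, this]

theorem bernoulliProb_exists_le (h₀ : ∀ e, 0 ≤ q e) (h₁ : ∀ e, q e ≤ 1) {I : Type} [Fintype I]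
    (A : I → (E → Bool) → Prop) :
    bernoulliProb q (fun G => ∃ i, A i G) ≤ ∑ i, bernoulliProb q (A i) := by
  simp only [bernoulliProb]
  rw [Finset.sum_comm]
  refine Finset.sum_le_sum fun G _ => ?_
  have := bernoulliWeight_nonneg h₀ h₁ G
  have h₂ : ∀ i ∈ Finset.univ, 0 ≤ (fun i : I => @ite ℝ (A i G) (Classical.propDecidable _)
      (bernoulliWeight q G) 0) i := fun i _ => by
    dsimp only
    split_ifs
    exacts [this, le_rfl]
  split_ifs with h
  · obtain ⟨i, hi⟩ := h
    refine le_trans ?_ (Finset.single_le_sum h₂ (Finset.mem_univ i))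
    simp [hi]
  · exact Finset.sum_nonneg h₂

/-- Total probability over the values of `h`, used below with `h` the history of an exploration. -/
theorem sum_bernoulliProb_eq {H : Type} [Fintype H] (h : (E → Bool) → H) :
    ∑ x, bernoulliProb q (fun G => h G = x) = 1 := by
  simp only [bernoulliProb]
  rw [Finset.sum_comm]
  classical
  simp [sum_bernoulliWeight]

/-- Events that depend on complementary sets of variables are independent. -/
theorem bernoulliProb_and (p : E → Prop) {A B : (E → Bool) → Prop}
    (hA : ∀ G G', (∀ e, p e → G e = G' e) → (A G ↔ A G'))
    (hB : ∀ G G', (∀ e, ¬ p e → G e = G' e) → (B G ↔ B G')) :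
    bernoulliProb q (fun G => A G ∧ B G) = bernoulliProb q A * bernoulliProb q B := by
  classical
  let φ := Equiv.piEquivPiSubtypeProd p fun _ : E => Bool
  let m (g : {e // p e} → Bool) (g' : {e // ¬ p e} → Bool) : E → Bool := φ.symm (g, g')
  have hm (g g') (e : E) : m g g' e = if h : p e then g ⟨e, h⟩ else g' ⟨e, h⟩ := rfl
  have hw (g g') : bernoulliWeight q (m g g') =
      bernoulliWeight (fun e : {e // p e} => q e) g *
        bernoulliWeight (fun e : {e // ¬ p e} => q e) g' := by
    rw [bernoulliWeight, ← Fintype.prod_subtype_mul_prod_subtype p]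
    congr 1
    · exact Finset.prod_congr rfl fun e _ => by rw [hm, dif_pos e.2]
    · exact Finset.prod_congr rfl fun e _ => by rw [hm, dif_neg e.2]
  -- Arbitrary fillers for the coordinates that the respective event ignores.
  let c : {e // p e} → Bool := fun _ => false
  let c' : {e // ¬ p e} → Bool := fun _ => false
  have eA (g g') : A (m g g') ↔ A (m g c') :=
    hA _ _ fun e he => by simp only [hm, dif_pos he]
  have eB (g g') : B (m g g') ↔ B (m c g') :=
    hB _ _ fun e he => by simp only [hm, dif_neg he]
  have key (C : (E → Bool) → Prop) : bernoulliProb q C =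
      ∑ g, ∑ g', if C (m g g') then bernoulliWeight (fun e : {e // p e} => q e) g *
        bernoulliWeight (fun e : {e // ¬ p e} => q e) g' else 0 := by
    rw [bernoulliProb, ← Equiv.sum_comp φ.symm, Fintype.sum_prod_type]
    refine Finset.sum_congr rfl fun g _ => Finset.sum_congr rfl fun g' _ => ?_
    rw [← hw]
  have keyA : bernoulliProb q A =
      ∑ g, if A (m g c') then bernoulliWeight (fun e : {e // p e} => q e) g else 0 := by
    rw [key]
    refine Finset.sum_congr rfl fun g _ => ?_
    simp only [eA]
    split_ifs
    · rw [← Finset.mul_sum, sum_bernoulliWeight, mul_one]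
    · simp
  have keyB : bernoulliProb q B =
      ∑ g', if B (m c g') then bernoulliWeight (fun e : {e // ¬ p e} => q e) g' else 0 := by
    rw [key, Finset.sum_comm]
    refine Finset.sum_congr rfl fun g _ => ?_
    simp only [eB]
    split_ifs
    · rw [← Finset.sum_mul, sum_bernoulliWeight, one_mul]
    · simp
  rw [key, keyA, keyB, Finset.sum_mul_sum]
  refine Finset.sum_congr rfl fun g _ => Finset.sum_congr rfl fun g' _ => ?_
  simp only [eA g g', eB g g', ite_and]
  split_ifs <;> simp

/-- All variables of a set are false with probability at most `exp (-∑ q)`. -/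
theorem bernoulliProb_all_false_le (h₁ : ∀ e, q e ≤ 1) (F : Finset E) :
    bernoulliProb q (fun G => ∀ e ∈ F, G e = false) ≤ Real.exp (-∑ e ∈ F, q e) := by
  -- The product of these factors is the indicator of the event.
  have h := sum_bernoulliWeight_mul_prod q fun e b => if e ∈ F ∧ b = true then 0 else 1
  have e₁ : bernoulliProb q (fun G => ∀ e ∈ F, G e = false) =
      ∏ e, (q e * (if e ∈ F ∧ true = true then 0 else 1) +
        (1 - q e) * (if e ∈ F ∧ false = true then 0 else 1)) := by
    rw [← h, bernoulliProb]
    refine Finset.sum_congr rfl fun G _ => ?_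
    split_ifs with hG
    · rw [Finset.prod_eq_one, mul_one]
      intro e _
      rw [if_neg]
      rintro ⟨he, h⟩
      simp [hG e he] at h
    · push Not at hG
      obtain ⟨e, he, hGe⟩ := hG
      rw [Finset.prod_eq_zero (Finset.mem_univ e), mul_zero]
      simp_all
  have e₂ : ∏ e, (q e * (if e ∈ F ∧ true = true then 0 else 1) +
        (1 - q e) * (if e ∈ F ∧ false = true then (0 : ℝ) else 1)) = ∏ e ∈ F, (1 - q e) := by
    rw [← Finset.prod_subset (Finset.subset_univ F)]
    · exact Finset.prod_congr rfl fun e he => by simp [he]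
    · intro e _ he
      simp [he]
  rw [e₁, e₂, ← Finset.sum_neg_distrib, Real.exp_sum]
  refine Finset.prod_le_prod (fun e _ => sub_nonneg.2 (h₁ e)) fun e _ => ?_
  have := Real.add_one_le_exp (-q e)
  linarith

/-- A Chernoff bound. -/
theorem bernoulliProb_card_gt_le (h₀ : ∀ e, 0 ≤ q e) (h₁ : ∀ e, q e ≤ 1) (F : Finset E) (M : ℝ) :
    bernoulliProb q (fun G => M < ((F.filter fun e => G e = true).card : ℝ)) ≤
      Real.exp (2 * ∑ e ∈ F, q e - M) := by
  -- Markov's inequality for the exponential of the number of true variables in `F`.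
  have h := sum_bernoulliWeight_mul_prod q fun e b =>
    if e ∈ F ∧ b = true then Real.exp 1 else 1
  have e₁ (G : E → Bool) : ∏ e, (if e ∈ F ∧ G e = true then Real.exp 1 else 1) =
      Real.exp ((F.filter fun e => G e = true).card) := by
    rw [Finset.prod_ite, Finset.prod_const_one, mul_one, Finset.prod_const, ← Real.exp_nat_mul,
      mul_one, Finset.filter_and, Finset.filter_mem_eq_inter, Finset.univ_inter,
      Finset.inter_filter, Finset.inter_univ]
  have e₂ : bernoulliProb q (fun G => M < ((F.filter fun e => G e = true).card : ℝ)) ≤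
      Real.exp (-M) * ∏ e, (q e * (if e ∈ F ∧ true = true then Real.exp 1 else 1) +
        (1 - q e) * (if e ∈ F ∧ false = true then Real.exp 1 else 1)) := by
    rw [← h, Finset.mul_sum, bernoulliProb]
    refine Finset.sum_le_sum fun G _ => ?_
    have hw := bernoulliWeight_nonneg h₀ h₁ G
    rw [e₁, mul_left_comm, ← Real.exp_add]
    split_ifs with hG
    · exact le_mul_of_one_le_right hw (Real.one_le_exp (by linarith))
    · positivity
  have e₃ : ∏ e, (q e * (if e ∈ F ∧ true = true then Real.exp 1 else 1) +
        (1 - q e) * (if e ∈ F ∧ false = true then Real.exp 1 else (1 : ℝ))) =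
      ∏ e ∈ F, (q e * Real.exp 1 + (1 - q e)) := by
    rw [← Finset.prod_subset (Finset.subset_univ F)]
    · exact Finset.prod_congr rfl fun e he => by simp [he]
    · intro e _ he
      simp [he]
  refine e₂.trans ?_
  rw [e₃, sub_eq_neg_add, Real.exp_add, Finset.mul_sum, Real.exp_sum]
  refine mul_le_mul_of_nonneg_left (Finset.prod_le_prod (fun e _ => ?_) fun e _ => ?_)
    (Real.exp_pos _).le
  · have := h₀ e
    have := h₁ e
    have := Real.exp_pos 1
    nlinarith
  -- The factor `1 + (e - 1) q` is at most `1 + 2 q ≤ exp (2 q)`, with `e` here Euler's number; this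
  -- is the source of the `2` in the bound.
  · have h₂ := Real.add_one_le_exp (2 * q e)
    have h₃ : Real.exp 1 ≤ 3 := Real.exp_one_lt_d9.le.trans (by norm_num)
    have := mul_le_mul_of_nonneg_left h₃ (h₀ e)
    linarith

end Bernoulli

end

noncomputable section

/-! ### The exploration of the random graph -/

namespace DoubleDigraph

variable {n : ℕ}

/-- The places of `R i`-edges from `S` to the complement of `U`. -/
def crossing (i : Fin 2) (S U : Finset (Fin n)) : Finset (Fin 2 × NodePair n) :=
  Finset.univ.filter fun e => e.1 = i ∧ e.2.1.1 ∈ S ∧ e.2.1.2 ∉ U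

/-- Since `S ⊆ U`, no pair from `S` to the complement of `U` is a loop, so every such pair is an
edge place. -/
theorem card_crossing (i : Fin 2) {S U : Finset (Fin n)} (hSU : S ⊆ U) :
    (crossing i S U).card = S.card * (n - U.card) := by
  have hc : n - U.card = Uᶜ.card := by rw [Finset.card_compl, Fintype.card_fin]
  rw [hc, ← Finset.card_product]
  refine Finset.card_bij (fun e _ => e.2.1) ?_ ?_ ?_
  · intro e he
    simpa [crossing] using (Finset.mem_filter.1 he).2.2
  · rintro ⟨i, e⟩ he ⟨j, e'⟩ he' h
    have h₁ := (Finset.mem_filter.1 he).2.1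
    have h₂ := (Finset.mem_filter.1 he').2.1
    exact Prod.ext (h₁.trans h₂.symm) (Subtype.ext h)
  · rintro ⟨c, b⟩ h
    rw [Finset.mem_product, Finset.mem_compl] at h
    exact ⟨(i, ⟨(c, b), fun e => h.2 (e ▸ hSU h.1)⟩), by simpa [crossing] using h, rfl⟩

variable (G : DoubleDigraph n)

theorem crossing_eq_false {i : Fin 2} {S U : Finset (Fin n)} (h : G.exits i S U = ∅) :
    ∀ e ∈ crossing i S U, G e = false := by
  rintro ⟨j, e⟩ he
  obtain ⟨-, rfl, hS, hU⟩ := Finset.mem_filter.1 he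
  by_contra hG
  rw [Bool.not_eq_false] at hG
  have : e.1.2 ∈ G.exits j S U := G.mem_exits.2 ⟨hU, e.1.1, hS, e.2, hG⟩
  simp [h] at this

theorem card_exits_le (i : Fin 2) (S U : Finset (Fin n)) :
    (G.exits i S U).card ≤ ((crossing i S U).filter fun e => G e = true).card := by
  refine (Finset.card_le_card fun b hb => ?_).trans
    (Finset.card_image_le (f := fun e : Fin 2 × NodePair n => e.2.1.2))
  obtain ⟨hU, c, hc, hne, hG⟩ := G.mem_exits.1 hb
  exact Finset.mem_image.2 ⟨(i, ⟨(c, b), hne⟩), by simp [crossing, hc, hU, hG], rfl⟩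

variable {G}

theorem next_congr {G' : DoubleDigraph n} {S : Finset (Fin n)} (U : Finset (Fin n))
    (h : ∀ e : Fin 2 × NodePair n, e.2.1.1 ∈ S → G e = G' e) : G.next S U = G'.next S U := by
  have h' : ∀ i, ∀ c ∈ S, ∀ b, G.R i c b ↔ G'.R i c b := fun i c hc b =>
    exists_congr fun hne => by rw [h (i, ⟨(c, b), hne⟩) hc]
  ext b
  rw [mem_next, mem_next]
  refine and_congr_right fun _ => or_congr
    (exists_congr fun c => and_congr_right fun hc => h' _ _ hc _)
    (and_congr (exists_congr fun c => and_congr_right fun hc => h' _ _ hc _)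
      (forall₂_congr fun d hd => forall_congr' fun e => imp_congr_left (h' _ _ hd _)))

/-- The exploration up to layer `j` never looks at an edge that starts outside the earlier layers.
This makes the history independent of the step that follows it. -/
theorem layer_congr {G' : DoubleDigraph n} {a : Fin n} {j : ℕ}
    (h : ∀ e : Fin 2 × NodePair n, (∃ i < j, e.2.1.1 ∈ G.layer a i) → G e = G' e) {i : ℕ}
    (hi : i ≤ j) : G.layer a i = G'.layer a i := by
  induction i using Nat.strong_induction_on with
  | _ i ih =>
  rcases i with _ | i
  · rw [layer_zero, layer_zero]
  · have hU : (fun m : Fin (i + 1) => G.layer a m) = fun m : Fin (i + 1) => G'.layer a m :=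
      funext fun m => ih m m.2 (by omega)
    rw [layer_succ, layer_succ, ← hU, ← ih i (by omega) (by omega)]
    exact next_congr _ fun e he => h e ⟨i, by omega, he⟩

end DoubleDigraph

open DoubleDigraph

variable {n : ℕ} {p : Fin 2 → ℝ}

/-- One step of the exploration fails with small probability. -/
theorem bernoulliProb_next_le (h₀ : ∀ i, 0 ≤ p i) (h₁ : ∀ i, p i ≤ 1) {M t D : ℝ}
    (hM₀ : p 0 * (M * n) ≤ M / 4) (hM₁ : p 1 * (t * n) ≤ M / 4) (hD₀ : D ≤ p 0 * (t * n / 2))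
    (hD₁ : D ≤ p 1 * (n / 2)) (hD : D ≤ M / 2) {S U : Finset (Fin n)} (hS : S.Nonempty)
    (hSU : S ⊆ U) (hSM : (S.card : ℝ) ≤ M) (hU : (U.card : ℝ) ≤ n / 2) :
    bernoulliProb (fun e : Fin 2 × NodePair n => p e.1)
      (fun G => ¬ ((DoubleDigraph.next G S U).Nonempty ∧
        ((DoubleDigraph.next G S U).card : ℝ) ≤ M)) ≤ 3 * Real.exp (-D) := by
  set q := fun e : Fin 2 × NodePair n => p e.1
  have hq₀ : ∀ e, 0 ≤ q e := fun e => h₀ e.1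
  have hq₁ : ∀ e, q e ≤ 1 := fun e => h₁ e.1
  have hUn : U.card ≤ n := by simpa using Finset.card_le_univ U
  have hsum (i : Fin 2) : ∑ e ∈ crossing i S U, q e = p i * (S.card * (n - U.card)) := by
    rw [Finset.sum_congr rfl (g := fun _ => p i) fun e he => by
      rw [← (Finset.mem_filter.1 he).2.1], Finset.sum_const, card_crossing i hSU, nsmul_eq_mul,
      Nat.cast_mul, Nat.cast_sub hUn, mul_comm]
  have hlow (i : Fin 2) {s : ℝ} (hs₀ : 0 ≤ s) (hs : s ≤ S.card) (hi : D ≤ p i * (s * n / 2)) :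
      bernoulliProb q (fun G => ∀ e ∈ crossing i S U, G e = false) ≤ Real.exp (-D) := by
    refine (bernoulliProb_all_false_le hq₁ _).trans (Real.exp_le_exp.2 (neg_le_neg ?_))
    rw [hsum]
    refine hi.trans (mul_le_mul_of_nonneg_left ?_ (h₀ i))
    rw [mul_div_assoc]
    exact mul_le_mul hs (by linarith) (by positivity) (by positivity)
  have hhigh (i : Fin 2) {s : ℝ} (hs : S.card ≤ s) (hi : p i * (s * n) ≤ M / 4) :
      bernoulliProb q (fun G => M < (((crossing i S U).filter fun e => G e = true).card : ℝ)) ≤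
        Real.exp (-D) := by
    refine (bernoulliProb_card_gt_le hq₀ hq₁ _ M).trans (Real.exp_le_exp.2 ?_)
    rw [hsum]
    have : p i * (S.card * (n - U.card)) ≤ p i * (s * n) := by
      refine mul_le_mul_of_nonneg_left (mul_le_mul hs ?_ ?_ ?_) (h₀ i)
      · have : (0 : ℝ) ≤ U.card := by positivity
        linarith
      · have : (0 : ℝ) ≤ n := by positivity
        linarith
      · exact le_trans (by positivity) hs
    linarith
  let A : DoubleDigraph n → Prop := fun G => ∀ e ∈ crossing 1 S U, G e = false
  let B : DoubleDigraph n → Prop := fun G =>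
    M < (((crossing 0 S U).filter fun e => G e = true).card : ℝ)
  have hA : bernoulliProb q A ≤ Real.exp (-D) :=
    hlow 1 zero_le_one (by exact_mod_cast hS.card_pos) (by rwa [one_mul])
  have hB : bernoulliProb q B ≤ Real.exp (-D) := hhigh 0 hSM hM₀
  -- An overlarge step by `R₂` is excluded in two ways. If `S` has at least `t` nodes, `R₁`-exits
  -- are unlikely to be missing; otherwise the `R₂`-exits are few by the Chernoff bound.
  obtain ⟨C, hC, hCG⟩ : ∃ C : DoubleDigraph n → Prop, bernoulliProb q C ≤ Real.exp (-D) ∧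
      ∀ G : DoubleDigraph n, G.exits 0 S U = ∅ → M < ((G.exits 1 S U).card : ℝ) → C G := by
    rcases le_total t S.card with ht | ht
    · refine ⟨_, hlow 0 (le_max_right t 0) (max_le ht (by positivity)) ?_,
        fun G h _ => crossing_eq_false G h⟩
      refine hD₀.trans (mul_le_mul_of_nonneg_left ?_ (h₀ 0))
      have := le_max_left t 0
      gcongr
    · refine ⟨_, hhigh 1 ht hM₁, fun G _ h => h.trans_le ?_⟩
      exact_mod_cast card_exits_le G 1 S U
  have hABC : ∀ G : DoubleDigraph n, ¬ ((G.next S U).Nonempty ∧ ((G.next S U).card : ℝ) ≤ M) →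
      (A G ∨ B G) ∨ C G := by
    intro G hG
    by_cases h0 : (G.exits 0 S U).Nonempty
    · rw [DoubleDigraph.next, if_pos h0] at hG
      have : M < (G.exits 0 S U).card := not_le.1 fun h => hG ⟨h0, h⟩
      exact Or.inl (Or.inr (this.trans_le (by exact_mod_cast card_exits_le G 0 S U)))
    · rw [DoubleDigraph.next, if_neg h0] at hG
      by_cases h1 : (G.exits 1 S U).Nonempty
      · exact Or.inr (hCG G (Finset.not_nonempty_iff_eq_empty.1 h0)
          (not_le.1 fun h => hG ⟨h1, h⟩))
      · exact Or.inl (Or.inl (crossing_eq_false G (Finset.not_nonempty_iff_eq_empty.1 h1)))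
  have h₂ := bernoulliProb_mono hq₀ hq₁ hABC
  have h₃ := bernoulliProb_or_le hq₀ hq₁ (fun G => A G ∨ B G) C
  have h₄ := bernoulliProb_or_le hq₀ hq₁ A B
  linarith

/-- The exploration fails with small probability. -/
theorem bernoulliProb_layers_le (h₀ : ∀ i, 0 ≤ p i) (h₁ : ∀ i, p i ≤ 1) {M t D : ℝ} {K : ℕ}
    (hM : 1 ≤ M) (hM₀ : p 0 * (M * n) ≤ M / 4) (hM₁ : p 1 * (t * n) ≤ M / 4)
    (hD₀ : D ≤ p 0 * (t * n / 2)) (hD₁ : D ≤ p 1 * (n / 2)) (hD : D ≤ M / 2)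
    (hK : K * M ≤ n / 2) :
    bernoulliProb (fun e : Fin 2 × NodePair n => p e.1) (fun G => ¬ ∀ (a : Fin n) (k : ℕ), k ≤ K →
      (DoubleDigraph.layer G a k).Nonempty ∧ ((DoubleDigraph.layer G a k).card : ℝ) ≤ M) ≤
      n * (K * (3 * Real.exp (-D))) := by
  set q := fun e : Fin 2 × NodePair n => p e.1
  have hq₀ : ∀ e, 0 ≤ q e := fun e => h₀ e.1
  have hq₁ : ∀ e, q e ≤ 1 := fun e => h₁ e.1
  let good (S : Finset (Fin n)) : Prop := S.Nonempty ∧ (S.card : ℝ) ≤ M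
  let fails (a : Fin n) (j : ℕ) (G : DoubleDigraph n) : Prop :=
    (∀ i ≤ j, good (G.layer a i)) ∧ ¬ good (G.layer a (j + 1))
  have hfirst : ∀ G : DoubleDigraph n,
      (¬ ∀ (a : Fin n) (k : ℕ), k ≤ K → good (G.layer a k)) →
        ∃ (a : Fin n) (j : Fin K), fails a j G := by
    intro G hG
    push Not at hG
    obtain ⟨a, k, hk⟩ := hG
    classical
    have hex : ∃ k, k ≤ K ∧ ¬ good (G.layer a k) := ⟨k, hk⟩
    obtain ⟨hle, hbad⟩ := Nat.find_spec hex
    have hmin : ∀ m < Nat.find hex, good (G.layer a m) := fun m hm => by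
      have := Nat.find_min hex hm
      by_contra h
      exact this ⟨by omega, h⟩
    -- The first bad layer is not layer `0`, a singleton, because `1 ≤ M`.
    obtain ⟨j, hj⟩ : ∃ j, Nat.find hex = j + 1 := by
      refine Nat.exists_eq_succ_of_ne_zero fun h => hbad ?_
      rw [h, layer_zero]
      exact ⟨Finset.singleton_nonempty a, by simpa using hM⟩
    rw [hj] at hle hbad hmin
    exact ⟨a, ⟨j, hle⟩, fun i hi => hmin i (Nat.lt_succ_of_le hi), hbad⟩
  have hstep : ∀ (a : Fin n) (j : Fin K),
      bernoulliProb q (fails a j) ≤ 3 * Real.exp (-D) := by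
    intro a j
    let hist (G : DoubleDigraph n) (i : Fin (j + 1)) : Finset (Fin n) := G.layer a i
    have hcover : bernoulliProb q (fails a j) ≤
        ∑ h, bernoulliProb q fun G => hist G = h ∧ fails a j G :=
      (bernoulliProb_mono hq₀ hq₁ fun G hG => ⟨hist G, rfl, hG⟩).trans
        (bernoulliProb_exists_le hq₀ hq₁ _)
    refine hcover.trans ?_
    rw [← one_mul (3 * Real.exp (-D)), ← sum_bernoulliProb_eq (q := q) hist, Finset.sum_mul]
    refine Finset.sum_le_sum fun h _ => ?_
    by_cases hex : ∃ G₀, hist G₀ = h ∧ fails a j G₀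
    swap
    · have : bernoulliProb q (fun G => hist G = h ∧ fails a j G) = 0 :=
        Finset.sum_eq_zero fun G _ => if_neg fun hG => hex ⟨G, hG⟩
      rw [this]
      exact mul_nonneg (bernoulliProb_nonneg hq₀ hq₁ _) (by positivity)
    -- A representative of the history turns the current layer and the set of used nodes into fixed
    -- sets, to which the one-step bound applies.
    obtain ⟨G₀, rfl, hG₀, -⟩ := hex
    set S := G₀.layer a j with hS
    set U := Finset.univ.biUnion fun m : Fin (j + 1) => G₀.layer a m with hU
    have hnext : ∀ G : DoubleDigraph n, hist G = hist G₀ → G.layer a (j + 1) = G.next S U := by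
      intro G hG
      have hG' : ∀ m : Fin (j + 1), G.layer a m = G₀.layer a m := fun m => congrFun hG m
      rw [layer_succ, hS, hU, ← hG' ⟨j, by omega⟩, ← Finset.biUnion_congr rfl fun m _ => hG' m]
    have hle : bernoulliProb q (fun G => hist G = hist G₀ ∧ fails a j G) ≤
        bernoulliProb q (fun G => hist G = hist G₀ ∧ ¬ good (DoubleDigraph.next G S U)) :=
      bernoulliProb_mono hq₀ hq₁ fun G hG => ⟨hG.1, fun hg => hG.2.2 (hnext G hG.1 ▸ hg)⟩
    refine hle.trans ?_
    have hlt {G : DoubleDigraph n} (hG : hist G = hist G₀) {i : ℕ} (hi : i ≤ j) :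
        G.layer a i = G₀.layer a i := congrFun hG ⟨i, by omega⟩
    have hhist : ∀ G G' : DoubleDigraph n, (∀ e : Fin 2 × NodePair n,
        (∃ i < (j : ℕ), e.2.1.1 ∈ G₀.layer a i) → G e = G' e) →
          hist G = hist G₀ → hist G' = hist G₀ := by
      intro G G' hGG' hG
      refine (funext fun i => ?_ : hist G' = hist G).trans hG
      refine (layer_congr (j := j) (fun e ⟨m, hm, he⟩ => hGG' e ⟨m, hm, ?_⟩) (by omega)).symm
      rwa [← hlt hG hm.le]
    -- The edges are split by whether they start in a layer before `j`: the history reads only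
    -- those, the next step only edges from layer `j`.
    rw [bernoulliProb_and (fun e : Fin 2 × NodePair n => ∃ i < (j : ℕ), e.2.1.1 ∈ G₀.layer a i)]
    · refine mul_le_mul_of_nonneg_left ?_ (bernoulliProb_nonneg hq₀ hq₁ _)
      obtain ⟨hne, hcard⟩ := hG₀ j le_rfl
      refine bernoulliProb_next_le h₀ h₁ hM₀ hM₁ hD₀ hD₁ hD hne ?_ hcard ?_
      · exact fun b hb => (mem_used G₀ a).2 ⟨j, le_rfl, hb⟩
      · calc (U.card : ℝ) ≤ ∑ m : Fin (j + 1), ((G₀.layer a m).card : ℝ) := by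
              exact_mod_cast Finset.card_biUnion_le
          _ ≤ ∑ m : Fin (j + 1), M := Finset.sum_le_sum fun m _ => (hG₀ m (by omega)).2
          _ = (j + 1 : ℕ) * M := by simp
          _ ≤ K * M := by
              have : (j : ℕ) + 1 ≤ K := j.2
              gcongr
          _ ≤ n / 2 := hK
    · exact fun G G' h => ⟨hhist G G' h, hhist G' G fun e he => (h e he).symm⟩
    · intro G G' h
      have : DoubleDigraph.next G S U = DoubleDigraph.next G' S U := next_congr U fun e he =>
        h e fun ⟨i, hi, he'⟩ => hi.ne (layer_unique he' he)
      rw [this]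
  calc _ ≤ bernoulliProb q fun G => ∃ (a : Fin n) (j : Fin K), fails a j G :=
        bernoulliProb_mono hq₀ hq₁ hfirst
    _ ≤ ∑ a : Fin n, bernoulliProb q fun G => ∃ j : Fin K, fails a j G :=
        bernoulliProb_exists_le hq₀ hq₁ _
    _ ≤ ∑ a : Fin n, ∑ j : Fin K, bernoulliProb q (fails a j) :=
        Finset.sum_le_sum fun a _ => bernoulliProb_exists_le hq₀ hq₁ _
    _ ≤ ∑ a : Fin n, ∑ j : Fin K, 3 * Real.exp (-D) :=
        Finset.sum_le_sum fun a _ => Finset.sum_le_sum fun j _ => hstep a j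
    _ = n * (K * (3 * Real.exp (-D))) := by simp

end

/-! ### Asymptotics -/

section Asymptotics

variable {α₁ α₂ : ℝ}

theorem prob_eq_bernoulliProb (n : ℕ) (P : DoubleDigraph n → Prop) :
    prob α₁ α₂ n P = bernoulliProb (fun e => edgeProb α₁ α₂ n e.1) P := rfl

theorem edgeProb_nonneg (n : ℕ) (i : Fin 2) : 0 ≤ edgeProb α₁ α₂ n i := by
  fin_cases i <;> exact Real.rpow_nonneg n.cast_nonneg _

theorem edgeProb_le_one (h₁ : 0 < α₁) (h₂ : α₂ < 1 / 4) {n : ℕ} (hn : 1 ≤ n) (i : Fin 2) :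
    edgeProb α₁ α₂ n i ≤ 1 := by
  have hn : (1 : ℝ) ≤ n := by exact_mod_cast hn
  fin_cases i
  · exact Real.rpow_le_one_of_one_le_of_nonpos hn (by linarith)
  · exact Real.rpow_le_one_of_one_le_of_nonpos hn (by linarith)

theorem prob_add_not (n : ℕ) (P : DoubleDigraph n → Prop) :
    prob α₁ α₂ n P + prob α₁ α₂ n (fun G => ¬ P G) = 1 :=
  bernoulliProb_add_not _ P

theorem prob_mono (h₁ : 0 < α₁) (h₂ : α₂ < 1 / 4) {n : ℕ} (hn : 1 ≤ n)
    {P Q : DoubleDigraph n → Prop} (h : ∀ G, P G → Q G) : prob α₁ α₂ n P ≤ prob α₁ α₂ n Q := by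
  have h₃ (e : Fin 2 × NodePair n) : 0 ≤ edgeProb α₁ α₂ n e.1 := edgeProb_nonneg n e.1
  have h₄ (e : Fin 2 × NodePair n) : edgeProb α₁ α₂ n e.1 ≤ 1 := edgeProb_le_one h₁ h₂ hn e.1
  exact bernoulliProb_mono h₃ h₄ h

theorem prob_le_one (h₁ : 0 < α₁) (h₂ : α₂ < 1 / 4) {n : ℕ} (hn : 1 ≤ n)
    (P : DoubleDigraph n → Prop) : prob α₁ α₂ n P ≤ 1 := by
  have h₃ (e : Fin 2 × NodePair n) : 0 ≤ edgeProb α₁ α₂ n e.1 := edgeProb_nonneg n e.1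
  have h₄ (e : Fin 2 × NodePair n) : edgeProb α₁ α₂ n e.1 ≤ 1 := edgeProb_le_one h₁ h₂ hn e.1
  have h := prob_add_not (α₁ := α₁) (α₂ := α₂) n P
  have : 0 ≤ prob α₁ α₂ n fun G => ¬ P G := bernoulliProb_nonneg h₃ h₄ _
  linarith

theorem prob_not_layers_le (h₁ : 0 < α₁) (h₁₂ : α₁ < α₂) (h₂ : α₂ < 1 / 4) {n : ℕ} (hn : 1 ≤ n)
    (hα₁ : 4 ≤ (n : ℝ) ^ α₁) (hδ : 4 ≤ (n : ℝ) ^ ((α₂ - α₁) / 2)) :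
    prob α₁ α₂ n (fun G => ¬ ∀ (a : Fin n) (k : ℕ), k ≤ ⌊(n : ℝ) ^ (1 - 2 * α₂) / 2⌋₊ →
      (G.layer a k).Nonempty ∧ ((G.layer a k).card : ℝ) ≤ (n : ℝ) ^ (2 * α₂)) ≤
      n * (n * (3 * Real.exp (-((n : ℝ) ^ ((α₂ - α₁) / 2) / 2)))) := by
  have hn' : (1 : ℝ) ≤ n := by exact_mod_cast hn
  have hpos : (0 : ℝ) < n := by linarith
  have hmul (a b c : ℝ) (h : a + b = c) : (n : ℝ) ^ a * (n : ℝ) ^ b = (n : ℝ) ^ c := by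
    rw [← Real.rpow_add hpos, h]
  have hmul₁ (a b c : ℝ) (h : a + b + 1 = c) :
      (n : ℝ) ^ a * ((n : ℝ) ^ b * n) = (n : ℝ) ^ c := by
    rw [← mul_assoc, hmul a b _ rfl, ← h, Real.rpow_add_one hpos.ne']
  have hK : (⌊(n : ℝ) ^ (1 - 2 * α₂) / 2⌋₊ : ℝ) ≤ (n : ℝ) ^ (1 - 2 * α₂) / 2 :=
    Nat.floor_le (by positivity)
  rw [prob_eq_bernoulliProb]
  -- Any threshold `t` with exponent strictly between `α₁` and `α₂` makes `p 0 * t * n` large and `p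
  -- 1 * t * n` small against `M`. The midpoint balances both margins at `n^((α₂-α₁)/2)`.
  refine (bernoulliProb_layers_le (p := edgeProb α₁ α₂ n) (edgeProb_nonneg n)
    (edgeProb_le_one h₁ h₂ hn) (M := (n : ℝ) ^ (2 * α₂)) (t := (n : ℝ) ^ ((α₁ + α₂) / 2))
    (D := (n : ℝ) ^ ((α₂ - α₁) / 2) / 2) ?_ ?_ ?_ ?_ ?_ ?_ ?_).trans ?_
  · exact Real.one_le_rpow hn' (by linarith)
  · change (n : ℝ) ^ (-(1 + α₁)) * _ ≤ _
    rw [hmul₁ _ _ (2 * α₂ - α₁) (by ring), ← hmul (2 * α₂ - α₁) α₁ (2 * α₂) (by ring)]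
    have := Real.rpow_nonneg hpos.le (2 * α₂ - α₁)
    nlinarith
  · change (n : ℝ) ^ (-(1 - α₂)) * _ ≤ _
    rw [hmul₁ _ _ (α₂ + (α₁ + α₂) / 2) (by ring),
      ← hmul (α₂ + (α₁ + α₂) / 2) ((α₂ - α₁) / 2) (2 * α₂) (by ring)]
    have := Real.rpow_nonneg hpos.le (α₂ + (α₁ + α₂) / 2)
    nlinarith
  · change _ ≤ (n : ℝ) ^ (-(1 + α₁)) * _
    rw [← mul_div_assoc, hmul₁ _ _ ((α₂ - α₁) / 2) (by ring)]
  · change _ ≤ (n : ℝ) ^ (-(1 - α₂)) * _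
    rw [← mul_div_assoc, ← Real.rpow_add_one hpos.ne']
    have := Real.rpow_le_rpow_of_exponent_le hn'
      (show (α₂ - α₁) / 2 ≤ -(1 - α₂) + 1 by linarith)
    linarith
  · have := Real.rpow_le_rpow_of_exponent_le hn' (show (α₂ - α₁) / 2 ≤ 2 * α₂ by linarith)
    linarith
  · refine (mul_le_mul_of_nonneg_right hK (by positivity)).trans ?_
    rw [div_mul_eq_mul_div, hmul _ _ 1 (by ring), Real.rpow_one]
  · have : (⌊(n : ℝ) ^ (1 - 2 * α₂) / 2⌋₊ : ℝ) ≤ n := by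
      have h := Real.rpow_le_rpow_of_exponent_le hn' (show 1 - 2 * α₂ ≤ 1 by linarith)
      rw [Real.rpow_one] at h
      linarith
    gcongr

theorem tendsto_sq_mul_exp_neg_rpow {δ : ℝ} (hδ : 0 < δ) :
    Tendsto (fun n : ℕ => (n : ℝ) * (n * (3 * Real.exp (-((n : ℝ) ^ δ / 2))))) atTop (𝓝 0) := by
  -- Substituting `x = n ^ δ` turns the factor `n ^ 2` into `x ^ (2 / δ)`.
  have h := (tendsto_rpow_mul_exp_neg_mul_atTop_nhds_zero (2 / δ) (1 / 2) (by norm_num)).comp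
    ((tendsto_rpow_atTop hδ).comp tendsto_natCast_atTop_atTop)
  have h' := h.const_mul 3
  rw [mul_zero] at h'
  refine h'.congr fun n => ?_
  simp only [Function.comp_apply]
  rw [← Real.rpow_mul n.cast_nonneg, mul_div_cancel₀ _ hδ.ne']
  norm_num
  rw [show -((n : ℝ) ^ δ / 2) = -(1 / 2 * (n : ℝ) ^ δ) by ring]
  ring_nf

theorem randomEnough_layers (h₁ : 0 < α₁) (h₁₂ : α₁ < α₂) (h₂ : α₂ < 1 / 4) :
    RandomEnough α₁ α₂ (fun n G => ∀ (a : Fin n) (k : ℕ), k ≤ ⌊(n : ℝ) ^ (1 - 2 * α₂) / 2⌋₊ →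
      (G.layer a k).Nonempty ∧ ((G.layer a k).card : ℝ) ≤ (n : ℝ) ^ (2 * α₂)) := by
  have hδ : 0 < (α₂ - α₁) / 2 := by linarith
  have hlow := (tendsto_sq_mul_exp_neg_rpow hδ).const_sub 1
  rw [sub_zero] at hlow
  refine tendsto_of_tendsto_of_tendsto_of_le_of_le' hlow tendsto_const_nhds ?_ ?_
  · filter_upwards [eventually_ge_atTop 1,
      ((tendsto_rpow_atTop h₁).comp tendsto_natCast_atTop_atTop).eventually_ge_atTop 4,
      ((tendsto_rpow_atTop hδ).comp tendsto_natCast_atTop_atTop).eventually_ge_atTop 4]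
      with n hn hn₁ hn₂
    refine (sub_le_sub_left (prob_not_layers_le h₁ h₁₂ h₂ hn hn₁ hn₂) 1).trans ?_
    exact (eq_sub_of_add_eq (prob_add_not n _)).ge
  · filter_upwards [eventually_ge_atTop 1] with n hn
    exact prob_le_one h₁ h₂ hn _

theorem RandomEnough.mono (h₁ : 0 < α₁) (h₂ : α₂ < 1 / 4) {P Q : ∀ n : ℕ, DoubleDigraph n → Prop}
    (hP : RandomEnough α₁ α₂ P) (h : ∀ n, 1 ≤ n → ∀ G, P n G → Q n G) :
    RandomEnough α₁ α₂ Q := by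
  refine tendsto_of_tendsto_of_tendsto_of_le_of_le' hP tendsto_const_nhds ?_ ?_
  · filter_upwards [eventually_ge_atTop 1] with n hn
    exact prob_mono h₁ h₂ hn (h n hn)
  · filter_upwards [eventually_ge_atTop 1] with n hn
    exact prob_le_one h₁ h₂ hn _

theorem randomEnough_height (h₁ : 0 < α₁) (h₁₂ : α₁ < α₂) (h₂ : α₂ < 1 / 4) :
    RandomEnough α₁ α₂ (fun n G => ⌊(n : ℝ) ^ (1 - 2 * α₂) / 2⌋₊ ≤ G.height) :=
  (randomEnough_layers h₁ h₁₂ h₂).mono h₁ h₂ fun n hn G hG => by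
    obtain ⟨b, hb⟩ := (hG ⟨0, hn⟩ _ le_rfl).1
    exact DoubleDigraph.le_height_of_mem hb

/-! ### Oscillation of the height and failure of the 0-1 law -/

/-- Here `α₂ < 1/4` enters: the exponent `1 - 2 * α₂` exceeds `1/2`, which gives the lower bound `√n
/ 2` uniformly in the parameters. One sentence can therefore serve all of them. -/
theorem le_floor_rpow (h₂ : α₂ < 1 / 4) {n Y : ℕ} (hn : 1 ≤ n) (h : 4 * Y ^ 2 ≤ n) :
    Y ≤ ⌊(n : ℝ) ^ (1 - 2 * α₂) / 2⌋₊ := by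
  refine Nat.le_floor ?_
  have hn' : (1 : ℝ) ≤ n := by exact_mod_cast hn
  have h₃ := Real.rpow_le_rpow_of_exponent_le hn' (show 1 / 2 ≤ 1 - 2 * α₂ by linarith)
  rw [← Real.sqrt_eq_rpow] at h₃
  have h₄ : 2 * (Y : ℝ) ≤ √n := by
    refine Real.le_sqrt_of_sq_le ?_
    have : (4 * Y ^ 2 : ℝ) ≤ n := by exact_mod_cast h
    linarith
  linarith

theorem heightSentence_of_height {n i : ℕ} {G : DoubleDigraph n} (hn : n = (2 ^ 16 ^ i) ^ 3)
    (h : 2 ^ 16 ^ i ≤ G.height) : heightSentence n G Fin.elim0 := by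
  refine ⟨i, h, (DoubleDigraph.height_le.trans hn.le).trans_lt ?_⟩
  rw [← pow_mul, mul_comm]
  exact Nat.pow_lt_pow_right one_lt_two (by have := pow_pos (show 0 < 16 by norm_num) i; omega)

/-- With `X = 2 ^ 16 ^ i`, the height lies in `[X^4, X^12]`. This is above the intervals with index
at most `i` and below the next one, which starts at `X^16`. -/
theorem not_heightSentence_of_height {n i : ℕ} {G : DoubleDigraph n}
    (hn : n = (2 ^ 16 ^ i) ^ 12) (h : (2 ^ 16 ^ i) ^ 4 ≤ G.height) :
    ¬ heightSentence n G Fin.elim0 := by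
  rintro ⟨j, h₁, h₂⟩
  rcases le_or_gt j i with hj | hj
  · have h₃ : 2 ^ (4 * 16 ^ j) ≤ 2 ^ (16 ^ i * 4) := by
      rw [mul_comm]
      gcongr <;> norm_num
    rw [pow_mul 2 (16 ^ i)] at h₃
    omega
  · have h₃ := (h₁.trans DoubleDigraph.height_le).trans hn.le
    have h₄ : 2 ^ 16 ^ (i + 1) ≤ 2 ^ 16 ^ j :=
      Nat.pow_le_pow_right two_pos (Nat.pow_le_pow_right (by norm_num) hj)
    have h₅ : (2 ^ 16 ^ i) ^ 12 < 2 ^ 16 ^ (i + 1) := by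
      rw [pow_succ 16, pow_mul]
      exact Nat.pow_lt_pow_right (Nat.one_lt_two_pow (by positivity)) (by norm_num)
    omega

theorem not_zeroOneLaw (h₁ : 0 < α₁) (h₁₂ : α₁ < α₂) (h₂ : α₂ < 1 / 4) {L : DefinabilityLogic}
    (hL : L 0 heightSentence) : ¬ ZeroOneLaw α₁ α₂ L := by
  intro h01
  obtain ⟨X, hX⟩ : ∃ X : ℕ → ℕ, X = fun i => 2 ^ 16 ^ i := ⟨_, rfl⟩
  have htower : Tendsto X atTop atTop := by
    rw [hX]
    exact (tendsto_pow_atTop_atTop_of_one_lt one_lt_two).comp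
      (tendsto_pow_atTop_atTop_of_one_lt (by norm_num : 1 < 16))
  have hsub (e : ℕ) (he : e ≠ 0) : Tendsto (fun i : ℕ => X i ^ e) atTop atTop :=
    (tendsto_pow_atTop he).comp htower
  -- A limit along all `n` is also the limit along `n = X i ^ e`, where `P` follows from an almost
  -- sure lower bound on the height. The `1` in `2 * d + 1` pays for the factor `4` in
  -- `le_floor_rpow` once `X i ≥ 4`.
  have hlim {e : ℕ} (d : ℕ) (hd : 2 * d + 1 ≤ e) {P : ∀ n : ℕ, DoubleDigraph n → Prop}
      (hP : ∀ i n, n = X i ^ e → ∀ G : DoubleDigraph n, X i ^ d ≤ G.height → P n G) {c : ℝ}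
      (hc : Tendsto (fun n => prob α₁ α₂ n (P n)) atTop (𝓝 c)) : 1 ≤ c := by
    have h := hsub e (by omega)
    have h₀ : Tendsto (fun n : ℕ => prob α₁ α₂ n fun G =>
        ⌊(n : ℝ) ^ (1 - 2 * α₂) / 2⌋₊ ≤ G.height) atTop (𝓝 1) := randomEnough_height h₁ h₁₂ h₂
    have h₃ : Tendsto (fun i => prob α₁ α₂ (X i ^ e) fun G =>
        ⌊((X i ^ e : ℕ) : ℝ) ^ (1 - 2 * α₂) / 2⌋₊ ≤ G.height) atTop (𝓝 1) := h₀.comp h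
    have h₄ : Tendsto (fun i => prob α₁ α₂ (X i ^ e) (P _)) atTop (𝓝 c) := hc.comp h
    refine le_of_tendsto_of_tendsto h₃ h₄ ?_
    filter_upwards [htower.eventually_ge_atTop 4] with i hi
    have hpos : 1 ≤ X i ^ e := Nat.one_le_pow _ _ (by omega)
    refine prob_mono h₁ h₂ hpos fun G hG => hP i _ rfl G ((le_floor_rpow h₂ hpos ?_).trans hG)
    calc 4 * (X i ^ d) ^ 2 ≤ X i * (X i ^ d) ^ 2 := Nat.mul_le_mul_right _ hi
      _ = X i ^ (2 * d + 1) := by ring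
      _ ≤ X i ^ e := Nat.pow_le_pow_right (by omega) hd
  rcases h01 heightSentence hL with h | h
  · have h' := hlim (e := 3) 1 (by norm_num) (P := fun n G => heightSentence n G Fin.elim0)
      (fun i n hn G hG => heightSentence_of_height (i := i) (by rw [hn, hX])
        (by rw [hX, pow_one] at hG; exact hG)) h
    norm_num at h'
  · have h' := hlim (e := 12) 4 (by norm_num) (P := fun n G => ¬ heightSentence n G Fin.elim0)
      (fun i n hn G hG => not_heightSentence_of_height (i := i) (by rw [hn, hX])
        (by rw [hX] at hG; exact hG))
      ((h.const_sub 1).congr fun n => (eq_sub_of_add_eq' (prob_add_not n _)).symm)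
    norm_num at h'

end Asymptotics

theorem mainTheorem2 :
    (∀ α₁ α₂ : ℝ, 0 < α₁ → α₁ < α₂ → α₂ < 1 / 4 →
      RandomEnough α₁ α₂ (fun n G => ∀ (a : Fin n) (k : ℕ), k ≤ ⌊(n : ℝ) ^ (1 - 2 * α₂) / 2⌋₊ →
        (G.layer a k).Nonempty ∧ ((G.layer a k).card : ℝ) ≤ (n : ℝ) ^ (2 * α₂)) ∧
      RandomEnough α₁ α₂ (fun n G => ⌊(n : ℝ) ^ (1 - 2 * α₂) / 2⌋₊ ≤ G.height)) ∧
    ∃ k₀ : ℕ, ∀ L : DefinabilityLogic,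
      (L = inductiveLogic ∨ ∃ k : ℕ, k₀ ≤ k ∧ L = infinitaryLogic k) →
        L 4 levelLE ∧
        (∃ S : ArithScheme 2, S.le = levelLE ∧ S.DefinableIn L ∧
          ∀ (n : ℕ) (G : DoubleDigraph n), 1 ≤ n → S.Interprets G (G.height + 1)) ∧
        ∀ α₁ α₂ : ℝ, 0 < α₁ → α₁ < α₂ → α₂ < 1 / 4 → ¬ ZeroOneLaw α₁ α₂ L := by
  -- Six variables are needed for the free variables of the graphs of addition and multiplication on
  -- pairs; the layers need only four.
  refine ⟨fun α₁ α₂ h₁ h₁₂ h₂ => ⟨randomEnough_layers h₁ h₁₂ h₂, randomEnough_height h₁ h₁₂ h₂⟩,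
    6, ?_⟩
  rintro L (rfl | ⟨k, hk, rfl⟩)
  · exact ⟨inductiveLogic.levelLE, ⟨levelScheme, rfl,
      ⟨inductiveLogic.hasLevel, inductiveLogic.levelEq, inductiveLogic.levelLE,
        inductiveLogic.levelAdd, inductiveLogic.levelMul⟩,
      fun n G hn => levelScheme_interprets G hn⟩,
      fun α₁ α₂ h₁ h₁₂ h₂ => not_zeroOneLaw h₁ h₁₂ h₂ inductiveLogic.heightSentence⟩
  · exact ⟨infinitaryLogic.levelLE hk, ⟨levelScheme, rfl,
      ⟨infinitaryLogic.hasLevel hk, infinitaryLogic.levelEq hk, infinitaryLogic.levelLE hk,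
        infinitaryLogic.levelAdd hk, infinitaryLogic.levelMul hk⟩,
      fun n G hn => levelScheme_interprets G hn⟩,
      fun α₁ α₂ h₁ h₁₂ h₂ => not_zeroOneLaw h₁ h₁₂ h₂ (infinitaryLogic.heightSentence hk)⟩
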